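/- Let $d\in\mathbb{N}$, let $x\sim\mathcal N(0,I_d)$, and write $\mathbb E_x$ for the expectation over $x$. Let $V\subset\mathbb R^d$ be a subspace and $f^*(x)=h^*(x_V)$, where $x_V$ is the orthogonal projection of $x$ onto $V$ and $h^*:V\to\mathbb R$ is a polynomial map. For $\theta=(a,w)\in\mathbb R\times\mathbb R^d$ and a probability measure $\rho$ on $\mathbb R^{d+1}$ put $$f_{\mathrm{NN}}(x;\rho)=\int a\,\sigma(w^\top x)\,\rho(da,dw),\qquad \Phi(\theta;\rho)=a\,\mathbb E_x\big[(f_{\mathrm{NN}}(x;\rho)-f^*(x))\,\sigma(w^\top x)\big].$$ Assume, for some constants $K_\sigma,K_\xi,K_\rho>0$: (i) $\sigma:\mathbb R\to\mathbb R$ is twice continuously differentiable and $|\sigma|,|\sigma'|,|\sigma''|\le K_\sigma$ everywhere; (ii) $\xi_a,\xi_w:[0,\infty)\to[0,K_\xi]$ are Lipschitz continuous with $\int_0^\infty\xi_a(t)\,dt=\int_0^\infty\xi_w(t)\,dt=+\infty$; (iii) $\rho_0=\rho_a\times\rho_w$, where $\rho_a$ is a symmetric probability measure on $\mathbb R$ supported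 in $[-K_\rho,K_\rho]$ and $\rho_w$ is a probability measure on $\mathbb R^d$. Let $(\rho_t)_{t\ge0}$ be a weak solution of the mean-field flow $$\partial_t\rho_t=\nabla_\theta\cdot\big(\rho_t\,\xi(t)\nabla_\theta\Phi(\theta;\rho_t)\big),\qquad \rho_t|_{t=0}=\rho_0,\qquad \xi(t)=\mathrm{diag}(\xi_a(t),\xi_w(t)I_d),$$ that is, a narrowly continuous curve of probability measures on $\mathbb R^{d+1}$ that starts at $\rho_0$, satisfies $\int_0^T\!\int|a|\,\rho_t(da,dw)\,dt<\infty$ for every $T>0$, and $$\int_0^\infty\!\!\int\big(-\partial_t\eta+\nabla_\theta\eta\cdot(\xi(t)\nabla_\theta\Phi(\theta;\rho_t))\big)\,\rho_t(d\theta)\,dt=0\qquad\text{for all }\eta\in C_c^\infty(\mathbb R^{d+1}\times(0,\infty)).$$ Let $S\subset\mathbb R^d$ be a subspace, let $x_S$ and $w_S$ be the orthogonal projections of $x$ and $w$ onto $S$, let $x_S^\perp=x-x_S$, let $\mathcal P_S:\mathbb R^{d+1}\to S$ be the map $(a,w)\mapsto w_S$, and let $\delta_S$ be the Dirac measure at $0$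 on $S$. If $(\mathcal P_S)_\#\rho_0=\delta_S$ and $$\mathbb E_x\big[f^*(x)\,\sigma'(w^\top x_S^\perp)\,x_S\big]=0\qquad\text{for all }w\in\mathbb R^d,$$ then $(\mathcal P_S)_\#\rho_t=\delta_S$ for all $t\ge0$. -/

import Mathlib

open MeasureTheory ProbabilityTheory Set
open scoped NNReal ContDiff

noncomputable section

/-- The input space `ℝ^d` with its Euclidean structure. -/
abbrev Inp (d : ℕ) : Type := EuclideanSpace ℝ (Fin d)

/-- The parameter space `ℝ^{d+1}` of a neuron `θ = (a, w)`. -/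
abbrev Param (d : ℕ) : Type := ℝ × Inp d

/-- A polynomial map on a subspace `V` of `ℝ^d`. A linear form on `V` extends to `ℝ^d`, so these are
exactly the restrictions to `V` of polynomials in the coordinates of `ℝ^d`. -/
def IsPolynomialMap {d : ℕ} (V : Submodule ℝ (Inp d)) (h : V → ℝ) : Prop :=
  ∃ p : MvPolynomial (Fin d) ℝ, ∀ z : V, h z = MvPolynomial.eval (fun i => (z : Inp d) i) p

/-- The target function is a subspace-sparse polynomial: `f(x) = h(x_V)`, where `x_V` is the
orthogonal projection of `x` onto `V` and `h` is a polynomial map on `V`. -/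
def IsSubspaceSparsePolynomial {d : ℕ} (V : Submodule ℝ (Inp d)) (f : Inp d → ℝ) : Prop :=
  ∃ h : V → ℝ, IsPolynomialMap V h ∧ ∀ x, f x = h (V.orthogonalProjectionOnto x)

/-- The activation is `C²`, and it and its first two derivatives are bounded by `K`. -/
structure ActivationAssumption (σ : ℝ → ℝ) (K : ℝ) : Prop where
  contDiff : ContDiff ℝ 2 σ
  bound : ∀ u, |σ u| ≤ K
  bound_deriv : ∀ u, |deriv σ u| ≤ K
  bound_deriv2 : ∀ u, |deriv (deriv σ) u| ≤ K

/-- A learning rate on `[0, ∞)`: nonnegative, bounded by `K`, Lipschitz, of infinite integral.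
Its values at negative times play no role. -/
structure LearningRateAssumption (ξ : ℝ → ℝ) (K : ℝ) : Prop where
  nonneg : ∀ t, 0 ≤ t → 0 ≤ ξ t
  bound : ∀ t, 0 ≤ t → ξ t ≤ K
  lipschitz : ∃ L : ℝ≥0, LipschitzOnWith L ξ (Ici 0)
  integral_eq_top : ∫⁻ t in Ici (0 : ℝ), ENNReal.ofReal (ξ t) = ⊤

/-- The initial law is a product `ρ_a × ρ_w` of probability measures, with `ρ_a` symmetric and
supported in `[-K, K]`. -/
def InitialAssumption {d : ℕ} (ρ₀ : Measure (Param d)) (K : ℝ) : Prop :=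
  ∃ (ρa : Measure ℝ) (ρw : Measure (Inp d)),
    IsProbabilityMeasure ρa ∧ IsProbabilityMeasure ρw ∧ ρ₀ = ρa.prod ρw ∧
      ρa.map (fun a => -a) = ρa ∧ ρa (Icc (-K) K)ᶜ = 0

/-- The infinite-width network `f_NN(x; ρ) = ∫ a σ(wᵀx) ρ(da, dw)`. -/
def fNN {d : ℕ} (σ : ℝ → ℝ) (ρ : Measure (Param d)) (x : Inp d) : ℝ :=
  ∫ θ, θ.1 * σ (inner ℝ θ.2 x) ∂ρ

/-- `Φ(θ; ρ) = a 𝔼_x[(f_NN(x; ρ) - f(x)) σ(wᵀx)]` for `θ = (a, w)` and `x ∼ N(0, I_d)`. -/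
def Phi {d : ℕ} (σ : ℝ → ℝ) (f : Inp d → ℝ) (ρ : Measure (Param d)) (θ : Param d) : ℝ :=
  θ.1 * ∫ x, (fNN σ ρ x - f x) * σ (inner ℝ θ.2 x) ∂(stdGaussian (Inp d))

/-- The partial derivative in `a` of a function of `θ = (a, w)`. -/
def derivA {d : ℕ} (F : Param d → ℝ) (θ : Param d) : ℝ :=
  deriv (fun a => F (a, θ.2)) θ.1

/-- The partial gradient in `w` of a function of `θ = (a, w)`. -/
def gradW {d : ℕ} (F : Param d → ℝ) (θ : Param d) : Inp d :=
  gradient (fun w => F (θ.1, w)) θ.2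

/-- Smooth test functions of `(θ, t)` with compact support in `ℝ^{d+1} × (0, ∞)`. -/
structure IsTestFunction {d : ℕ} (η : Param d × ℝ → ℝ) : Prop where
  smooth : ContDiff ℝ ∞ η
  compact : HasCompactSupport η
  support : tsupport η ⊆ {q | 0 < q.2}

/-- `ρ` is a weak solution of
`∂_t ρ_t = ∇_θ · (ρ_t ξ(t) ∇_θ Φ(θ; ρ_t))` on `[0, ∞)` with initial value `ρ₀`, where
`ξ(t) = diag(ξa(t), ξw(t) I_d)`: a narrowly continuous curve of probability measures (the topology of
`ProbabilityMeasure` is that of weak convergence) that starts at `ρ₀` and satisfies the equation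
against all test functions. The condition `integrable` says that the coordinate `a` is integrable
for `ρ_t(dθ) dt` on bounded time intervals; it makes `f_NN(·; ρ_t)`, and with it the integrals in
the weak equation, absolutely convergent. -/
structure IsMeanFieldSolution {d : ℕ} (σ : ℝ → ℝ) (f : Inp d → ℝ) (ξa ξw : ℝ → ℝ)
    (ρ₀ : Measure (Param d)) (ρ : ℝ → ProbabilityMeasure (Param d)) : Prop where
  initial : (ρ 0 : Measure (Param d)) = ρ₀
  continuousOn : ContinuousOn ρ (Ici 0)
  integrable : ∀ T : ℝ, ∫⁻ t in Ioc 0 T, ∫⁻ θ, ‖θ.1‖ₑ ∂(ρ t : Measure (Param d)) < ⊤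
  weak : ∀ η : Param d × ℝ → ℝ, IsTestFunction η →
    ∫ t in Ioi (0 : ℝ), ∫ θ,
      (-deriv (fun s => η (θ, s)) t
        + (ξa t * (derivA (fun θ' => η (θ', t)) θ * derivA (Phi σ f (ρ t)) θ)
          + ξw t * inner ℝ (gradW (fun θ' => η (θ', t)) θ) (gradW (Phi σ f (ρ t)) θ)))
      ∂(ρ t : Measure (Param d)) = 0

/-- The map `(a, w) ↦ w_S` from `ℝ^{d+1}` to `S`. -/
def projS {d : ℕ} (S : Submodule ℝ (Inp d)) (θ : Param d) : S :=
  S.orthogonalProjectionOnto θ.2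

end

/-!
A solution of the flow solves a continuity equation whose velocity has, at time `t`, an
`a`-component bounded by an integrable function of `t`. Testing with `exp (-n χ(a))` for a cutoff
`χ` and letting `n → ∞` shows that `ρ_t` has bounded support in `a`, locally uniformly in `t`. On
such a support the `S`-component of the velocity of `w` is at most
`C (‖w_S‖ + ∫ min 1 ‖w'_S‖ ρ_t(da', dw'))`: if `w_S` vanishes and the network depends on `x - x_S`
only, then the network term of the gradient vanishes because the reflection `x_S ↦ -x_S` preserves
the Gaussian measure, and the target term vanishes by assumption. Grönwall's inequality for the
integral of `‖w_S‖² / (1 + ‖w_S‖²)` against `ρ_t` concludes.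
-/

open Filter Topology

noncomputable section

/-! ### Weak derivatives in time -/

section TimeCutoff

/-- A smooth approximation, for small `ε > 0`, of the indicator function of `(s, ∞)`: it vanishes
on `(-∞, s + ε]` and equals `1` on `[s + 2ε, ∞)`. -/
def smoothStep (ε s x : ℝ) : ℝ := Real.smoothTransition ((x - s) / ε - 1)

variable {ε s x : ℝ}

theorem contDiff_smoothStep : ContDiff ℝ ∞ (smoothStep ε s) :=
  Real.smoothTransition.contDiff.comp (((contDiff_id.sub contDiff_const).div_const ε).sub
    contDiff_const)

theorem abs_smoothStep_le_one : |smoothStep ε s x| ≤ 1 :=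
  abs_le.2 ⟨neg_one_lt_zero.le.trans (Real.smoothTransition.nonneg _),
    Real.smoothTransition.le_one _⟩

theorem smoothStep_of_le (hε : 0 < ε) (hx : x ≤ s + ε) : smoothStep ε s x = 0 :=
  Real.smoothTransition.zero_of_nonpos (by rw [sub_nonpos, div_le_one hε]; linarith)

theorem smoothStep_of_ge (hε : 0 < ε) (hx : s + 2 * ε ≤ x) : smoothStep ε s x = 1 :=
  Real.smoothTransition.one_of_one_le (by rw [le_sub_iff_add_le, le_div_iff₀ hε]; linarith)

theorem deriv_smoothStep :
    deriv (smoothStep ε s) x = ε⁻¹ * deriv Real.smoothTransition ((x - s) / ε - 1) := by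
  have h : HasDerivAt (fun y => (y - s) / ε - 1) ε⁻¹ x := by
    simpa using (((hasDerivAt_id x).sub_const s).div_const ε).sub_const 1
  have h' : DifferentiableAt ℝ Real.smoothTransition ((x - s) / ε - 1) :=
    (Real.smoothTransition.contDiff (n := 1)).differentiable one_ne_zero _
  exact (h'.hasDerivAt.comp x h).deriv.trans (mul_comm _ _)

theorem deriv_smoothStep_of_notMem (hε : 0 < ε) (hx : x ∉ Icc (s + ε) (s + 2 * ε)) :
    deriv (smoothStep ε s) x = 0 := by
  rcases lt_or_ge x (s + ε) with h | h
  · refine EventuallyEq.deriv_eq (f := fun _ => (0 : ℝ)) ?_ |>.trans (deriv_const x 0)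
    filter_upwards [Iio_mem_nhds h] with y hy using smoothStep_of_le hε hy.le
  · refine EventuallyEq.deriv_eq (f := fun _ => (1 : ℝ)) ?_ |>.trans (deriv_const x 1)
    filter_upwards [Ioi_mem_nhds (not_le.1 fun h' => hx ⟨h, h'⟩)] with y hy
    exact smoothStep_of_ge hε hy.le

theorem tendsto_smoothStep (s x : ℝ) :
    Tendsto (fun ε => smoothStep ε s x) (𝓝[>] 0) (𝓝 (indicator (Ioi s) 1 x)) := by
  refine tendsto_nhds_of_eventually_eq ?_
  rcases le_or_gt x s with h | h
  · rw [indicator_of_notMem (notMem_Ioi.2 h)]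
    filter_upwards [self_mem_nhdsWithin] with ε hε
    exact smoothStep_of_le hε (h.trans (lt_add_of_pos_right s hε).le)
  · rw [indicator_of_mem (mem_Ioi.2 h)]
    filter_upwards [Ioo_mem_nhdsGT (half_pos (sub_pos.2 h))] with ε hε
    exact smoothStep_of_ge hε.1 (by linarith [hε.2])

theorem integral_deriv_smoothStep_mul (hε : 0 < ε) (H : ℝ → ℝ) :
    ∫ x, deriv (smoothStep ε s) x * H x =
      ∫ y in (0 : ℝ)..1, deriv Real.smoothTransition y * H (s + ε * (y + 1)) := by
  have hsupp : ∀ x ∉ Icc (s + ε) (s + 2 * ε), deriv (smoothStep ε s) x * H x = 0 :=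
    fun x hx => by rw [deriv_smoothStep_of_notMem hε hx, zero_mul]
  rw [← setIntegral_eq_integral_of_forall_compl_eq_zero hsupp, integral_Icc_eq_integral_Ioc,
    ← intervalIntegral.integral_of_le (by linarith)]
  have hsubst := intervalIntegral.smul_integral_comp_mul_add
    (fun x => deriv (smoothStep ε s) x * H x) ε (s + ε) (a := 0) (b := 1)
  rw [show ε * 0 + (s + ε) = s + ε by ring, show ε * 1 + (s + ε) = s + 2 * ε by ring] at hsubst
  rw [← hsubst, smul_eq_mul, ← intervalIntegral.integral_const_mul]
  refine intervalIntegral.integral_congr fun y _ => ?_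
  have hy : (ε * y + (s + ε) - s) / ε - 1 = y := by field_simp; ring
  simp only [deriv_smoothStep, hy]
  rw [show ε * y + (s + ε) = s + ε * (y + 1) by ring]
  field_simp

theorem tendsto_integral_deriv_smoothStep_mul {H : ℝ → ℝ} (hH : Continuous H) (s : ℝ) :
    Tendsto (fun ε => ∫ x, deriv (smoothStep ε s) x * H x) (𝓝[>] 0) (𝓝 (H s)) := by
  have hφ : ContDiff ℝ 1 Real.smoothTransition := Real.smoothTransition.contDiff
  have hcont : Continuous fun ε : ℝ =>
      ∫ y in (0 : ℝ)..1, deriv Real.smoothTransition y * H (s + ε * (y + 1)) := by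
    refine intervalIntegral.continuous_parametric_intervalIntegral_of_continuous' ?_ 0 1
    have : Continuous (deriv Real.smoothTransition) := hφ.continuous_deriv le_rfl
    simp only [Function.uncurry_def]
    fun_prop
  have hmass : ∫ y in (0 : ℝ)..1, deriv Real.smoothTransition y * H (s + 0 * (y + 1)) = H s := by
    simp only [zero_mul, add_zero]
    rw [intervalIntegral.integral_mul_const,
      intervalIntegral.integral_deriv_eq_sub (fun y _ => hφ.differentiable one_ne_zero y)
        ((hφ.continuous_deriv le_rfl).intervalIntegrable 0 1), Real.smoothTransition.one,
      Real.smoothTransition.zero, sub_zero, one_mul]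
  have hlim := (hcont.tendsto 0).mono_left (nhdsWithin_le_nhds (s := Ioi 0))
  rw [hmass] at hlim
  refine hlim.congr' ?_
  filter_upwards [self_mem_nhdsWithin] with ε hε using (integral_deriv_smoothStep_mul hε H).symm

theorem integrable_deriv_smoothStep_mul (hε : 0 < ε) {H : ℝ → ℝ} (hH : Continuous H) :
    Integrable fun x => deriv (smoothStep ε s) x * H x := by
  have hsmooth : ContDiff ℝ 1 (smoothStep ε s) := contDiff_smoothStep.of_le (by simp)
  refine ((hsmooth.continuous_deriv le_rfl).mul hH).integrable_of_hasCompactSupport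
    (HasCompactSupport.intro (isCompact_Icc (a := s + ε) (b := s + 2 * ε)) fun x hx => ?_)
  rw [Pi.mul_apply, deriv_smoothStep_of_notMem hε hx, zero_mul]

theorem smoothStep_sub_smoothStep_of_notMem {t : ℝ} (hε : 0 < ε) (hst : s ≤ t)
    (hx : x ∉ Icc (s + ε) (t + 2 * ε)) : smoothStep ε s x - smoothStep ε t x = 0 := by
  rcases lt_or_ge x (s + ε) with h | h
  · rw [smoothStep_of_le hε h.le, smoothStep_of_le hε (by linarith), sub_zero]
  · have h' : t + 2 * ε < x := not_le.1 fun h' => hx ⟨h, h'⟩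
    rw [smoothStep_of_ge hε (by linarith), smoothStep_of_ge hε h'.le, sub_self]

theorem abs_smoothStep_sub_smoothStep_le {t : ℝ} : |smoothStep ε s x - smoothStep ε t x| ≤ 2 := by
  linarith [abs_sub (smoothStep ε s x) (smoothStep ε t x),
    abs_smoothStep_le_one (ε := ε) (s := s) (x := x),
    abs_smoothStep_le_one (ε := ε) (s := t) (x := x)]

theorem integrable_smoothStep_sub_mul {G : ℝ → ℝ} {t : ℝ} (hε : 0 < ε) (hst : s ≤ t)
    (hG : IntegrableOn G (Icc (s + ε) (t + 2 * ε))) :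
    Integrable fun x => (smoothStep ε s x - smoothStep ε t x) * G x := by
  have hcont : Continuous fun x => smoothStep ε s x - smoothStep ε t x :=
    (contDiff_smoothStep.sub contDiff_smoothStep).continuous (n := ∞)
  refine IntegrableOn.integrable_of_forall_notMem_eq_zero (s := Icc (s + ε) (t + 2 * ε))
    (hG.bdd_mul hcont.aestronglyMeasurable
      (.of_forall fun x => abs_smoothStep_sub_smoothStep_le)) fun x hx => ?_
  rw [smoothStep_sub_smoothStep_of_notMem hε hst hx, zero_mul]

theorem tendsto_integral_smoothStep_sub_mul {G : ℝ → ℝ} {t : ℝ}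
    (hG : IntegrableOn G (Ioc s (t + 2))) (hst : s ≤ t) :
    Tendsto (fun ε => ∫ x, (smoothStep ε s x - smoothStep ε t x) * G x) (𝓝[>] 0)
      (𝓝 (∫ x in s..t, G x)) := by
  have hsupp : ∀ ε ∈ Ioo (0 : ℝ) 1, ∀ x ∉ Ioc s (t + 2),
      smoothStep ε s x - smoothStep ε t x = 0 := fun ε hε x hx =>
    smoothStep_sub_smoothStep_of_notMem hε.1 hst
      fun h => hx ⟨by linarith [h.1, hε.1], by linarith [h.2, hε.2]⟩
  have hlim : ∫ x in s..t, G x =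
      ∫ x in Ioc s (t + 2), (indicator (Ioi s) 1 x - indicator (Ioi t) 1 x) * G x := by
    rw [intervalIntegral.integral_of_le hst, ← inter_eq_right.2
      (Ioc_subset_Ioc_right (by linarith) : Ioc s t ⊆ Ioc s (t + 2)),
      ← setIntegral_indicator measurableSet_Ioc]
    refine setIntegral_congr_fun measurableSet_Ioc fun x hx => ?_
    by_cases hxt : x ≤ t <;> simp [indicator, hx.1, hxt, not_lt.2, not_le.1]
  have hcont : ∀ ε, Continuous fun x => smoothStep ε s x - smoothStep ε t x := fun ε =>
    (contDiff_smoothStep.sub contDiff_smoothStep).continuous (n := ∞)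
  rw [hlim]
  refine (tendsto_integral_filter_of_dominated_convergence
    (F := fun ε x => (smoothStep ε s x - smoothStep ε t x) * G x) (fun x => 2 * |G x|) ?_ ?_
    (hG.abs.const_mul 2) ?_).congr' ?_
  · exact .of_forall fun ε => (hcont ε).aestronglyMeasurable.mul hG.aestronglyMeasurable
  · refine .of_forall fun ε => .of_forall fun x => ?_
    rw [norm_mul, Real.norm_eq_abs, Real.norm_eq_abs]
    gcongr
    exact abs_smoothStep_sub_smoothStep_le
  · exact .of_forall fun x => ((tendsto_smoothStep s x).sub (tendsto_smoothStep t x)).mul_const _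
  · filter_upwards [Ioo_mem_nhdsGT one_pos] with ε hε
    exact setIntegral_eq_integral_of_forall_compl_eq_zero fun x hx => by
      rw [hsupp ε hε x hx, zero_mul]

end TimeCutoff

section WeakDerivative

variable {H G : ℝ → ℝ} {s t : ℝ}

theorem integral_deriv_smoothStep_sub_eq_of_weak_deriv (hH : Continuous H)
    (hG : ∀ T, IntegrableOn G (Ioc 0 T))
    (hweak : ∀ p : ℝ → ℝ, ContDiff ℝ ∞ p → HasCompactSupport p → tsupport p ⊆ Ioi 0 →
      ∫ x in Ioi 0, (deriv p x * H x + p x * G x) = 0)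
    (hs : 0 ≤ s) (hst : s ≤ t) {ε : ℝ} (hε : 0 < ε) :
    (∫ x, deriv (smoothStep ε t) x * H x) - ∫ x, deriv (smoothStep ε s) x * H x =
      ∫ x, (smoothStep ε s x - smoothStep ε t x) * G x := by
  have hp : ContDiff ℝ ∞ (smoothStep ε s - smoothStep ε t) :=
    contDiff_smoothStep.sub contDiff_smoothStep
  have hzero : ∀ x ∉ Icc (s + ε) (t + 2 * ε), (smoothStep ε s - smoothStep ε t) x = 0 :=
    fun x hx => smoothStep_sub_smoothStep_of_notMem hε hst hx
  have hsub : Icc (s + ε) (t + 2 * ε) ⊆ Ioi 0 := fun x hx =>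
    lt_of_lt_of_le (by linarith) hx.1
  have hsupp : tsupport (smoothStep ε s - smoothStep ε t) ⊆ Ioi 0 :=
    (closure_minimal (Function.support_subset_iff'.2 hzero) isClosed_Icc).trans hsub
  have hderiv : ∀ x, deriv (smoothStep ε s - smoothStep ε t) x =
      deriv (smoothStep ε s) x - deriv (smoothStep ε t) x := fun x =>
    deriv_sub (contDiff_smoothStep.differentiable (n := ∞) (by simp) x)
      (contDiff_smoothStep.differentiable (n := ∞) (by simp) x)
  have htest := hweak _ hp (.intro isCompact_Icc hzero) hsupp
  rw [setIntegral_eq_integral_of_forall_compl_eq_zero fun x hx => by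
    rw [image_eq_zero_of_notMem_tsupport fun h => hx (hsupp h),
      image_eq_zero_of_notMem_tsupport fun h => hx (hsupp (tsupport_deriv_subset h))]; simp]
    at htest
  simp only [hderiv, sub_mul (deriv _ _), Pi.sub_apply] at htest
  have hds := integrable_deriv_smoothStep_mul (s := s) hε hH
  have hdt := integrable_deriv_smoothStep_mul (s := t) hε hH
  have hpG : Integrable fun x => (smoothStep ε s x - smoothStep ε t x) * G x :=
    integrable_smoothStep_sub_mul hε hst ((hG (t + 2 * ε)).mono_set fun x hx => ⟨hsub hx, hx.2⟩)
  rw [integral_add (by exact hds.sub hdt) hpG, integral_sub hds hdt] at htest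
  linarith

theorem sub_eq_integral_of_weak_deriv (hH : Continuous H)
    (hG : ∀ T, IntegrableOn G (Ioc 0 T))
    (hweak : ∀ p : ℝ → ℝ, ContDiff ℝ ∞ p → HasCompactSupport p → tsupport p ⊆ Ioi 0 →
      ∫ x in Ioi 0, (deriv p x * H x + p x * G x) = 0)
    (hs : 0 ≤ s) (hst : s ≤ t) :
    H t - H s = ∫ r in s..t, G r := by
  refine tendsto_nhds_unique (((tendsto_integral_deriv_smoothStep_mul hH t).sub
    (tendsto_integral_deriv_smoothStep_mul hH s)).congr' ?_)
    (tendsto_integral_smoothStep_sub_mul ((hG _).mono_set (Ioc_subset_Ioc_left hs)) hst)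
  filter_upwards [self_mem_nhdsWithin] with ε hε
  exact integral_deriv_smoothStep_sub_eq_of_weak_deriv hH hG hweak hs hst hε

end WeakDerivative

/-! ### Grönwall's inequality -/

theorem absolutelyContinuousOnInterval_comp_of_lipschitzOnWith {X Y : Type*}
    [PseudoMetricSpace X] [PseudoMetricSpace Y] {f : ℝ → X} {g : X → Y} {K : ℝ≥0} {s : Set X}
    {a b : ℝ} (hg : LipschitzOnWith K g s) (hf : AbsolutelyContinuousOnInterval f a b)
    (hfs : MapsTo f (uIcc a b) s) : AbsolutelyContinuousOnInterval (fun t => g (f t)) a b := by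
  have hlim := Tendsto.const_mul (K : ℝ) hf
  rw [mul_zero] at hlim
  refine squeeze_zero' (.of_forall fun E => Finset.sum_nonneg fun i _ => dist_nonneg) ?_ hlim
  filter_upwards [mem_inf_of_right (mem_principal_self _)] with E hE
  rw [Finset.mul_sum]
  exact Finset.sum_le_sum fun i hi =>
    hg.dist_le_mul _ (hfs (hE.1 i hi).1) _ (hfs (hE.1 i hi).2)

theorem absolutelyContinuousOnInterval_exp_comp {f : ℝ → ℝ} {a b : ℝ}
    (hf : AbsolutelyContinuousOnInterval f a b) :
    AbsolutelyContinuousOnInterval (fun t => Real.exp (f t)) a b := by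
  obtain ⟨M, hM⟩ := hf.exists_bound
  obtain ⟨K, hK⟩ := (Real.contDiff_exp (n := 1)).contDiffOn.exists_lipschitzOnWith one_ne_zero
    (convex_Icc (-M) M) isCompact_Icc
  have hmaps : MapsTo f (uIcc a b) (Icc (-M) M) := fun x hx => abs_le.1 (hM x hx)
  exact absolutelyContinuousOnInterval_comp_of_lipschitzOnWith hK hf hmaps

theorem le_mul_exp_of_le_add_integral {F c : ℝ → ℝ} {a b : ℝ} (hab : a ≤ b)
    (hc : IntervalIntegrable c volume a b) (hc0 : ∀ t ∈ Icc a b, 0 ≤ c t)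
    (hF : ContinuousOn F (uIcc a b)) (hFle : ∀ t ∈ Icc a b, F t ≤ F a + ∫ r in a..t, c r * F r) :
    F b ≤ F a * Real.exp (∫ r in a..b, c r) := by
  have hcF : IntervalIntegrable (fun r => c r * F r) volume a b := hc.mul_continuousOn hF
  let C : ℝ → ℝ := fun t => ∫ r in a..t, c r
  let G : ℝ → ℝ := fun t => F a + ∫ r in a..t, c r * F r
  let P : ℝ → ℝ := fun t => Real.exp (-C t)
  have hG : AbsolutelyContinuousOnInterval G a b :=
    (LipschitzWith.const (F a)).lipschitzOnWith.absolutelyContinuousOnInterval.add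
      (hcF.absolutelyContinuousOnInterval_intervalIntegral left_mem_uIcc)
  have hP : AbsolutelyContinuousOnInterval P a b :=
    absolutelyContinuousOnInterval_exp_comp
      (hc.absolutelyContinuousOnInterval_intervalIntegral left_mem_uIcc).neg
  have hderiv : ∀ᵐ t, t ∈ uIoc a b → deriv G t * P t + G t * deriv P t ≤ 0 := by
    filter_upwards [hc.ae_hasDerivAt_integral, hcF.ae_hasDerivAt_integral] with t hCt hGt ht
    have hmem := uIoc_subset_uIcc ht
    have hP' : HasDerivAt P (P t * -c t) t := (hCt hmem a left_mem_uIcc).neg.exp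
    have hG' : HasDerivAt G (c t * F t) t := (hGt hmem a left_mem_uIcc).const_add _
    rw [uIcc_of_le hab] at hmem
    rw [hP'.deriv, hG'.deriv, show c t * F t * P t + G t * (P t * -c t) =
      -(c t * P t * (G t - F t)) by ring, neg_nonpos]
    exact mul_nonneg (mul_nonneg (hc0 t hmem) (Real.exp_pos _).le) (sub_nonneg.2 (hFle t hmem))
  have hdecr : G b * P b ≤ F a := by
    have hparts := hG.integral_deriv_mul_eq_sub hP
    have hnonpos : ∫ t in a..b, deriv G t * P t + G t * deriv P t ≤ 0 := by
      rw [intervalIntegral.integral_of_le hab]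
      rw [uIoc_of_le hab] at hderiv
      exact integral_nonpos_of_ae ((ae_restrict_iff' measurableSet_Ioc).2 hderiv)
    have hGa : G a = F a := by simp [G]
    have hPa : P a = 1 := by simp [P, C]
    rw [hGa, hPa] at hparts
    linarith
  calc F b ≤ G b := hFle b (right_mem_Icc.2 hab)
    _ = G b * P b * Real.exp (C b) := by simp only [P]; rw [mul_assoc, ← Real.exp_add]; simp
    _ ≤ F a * Real.exp (C b) := by gcongr

/-! ### Smooth cutoffs -/

theorem norm_fderiv_mul_le {E : Type*} [NormedAddCommGroup E] [NormedSpace ℝ E] {f g : E → ℝ}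
    {A A' C C' : ℝ} {x : E} (hf : DifferentiableAt ℝ f x) (hg : DifferentiableAt ℝ g x)
    (hA : |f x| ≤ A) (hA' : ‖fderiv ℝ f x‖ ≤ A') (hC : |g x| ≤ C) (hC' : ‖fderiv ℝ g x‖ ≤ C') :
    ‖fderiv ℝ (fun y => f y * g y) x‖ ≤ A * C' + C * A' := by
  rw [fderiv_fun_mul hf hg]
  refine (norm_add_le _ _).trans (add_le_add ?_ ?_)
  · rw [norm_smul]
    exact mul_le_mul hA hC' (norm_nonneg _) ((abs_nonneg _).trans hA)
  · rw [norm_smul]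
    exact mul_le_mul hC hA' (norm_nonneg _) ((abs_nonneg _).trans hC)

theorem norm_fderiv_comp_le {E F : Type*} [NormedAddCommGroup E] [NormedSpace ℝ E]
    [NormedAddCommGroup F] [NormedSpace ℝ F] {h : F → ℝ} {C : ℝ} (L : E →L[ℝ] F) {x : E}
    (hh : DifferentiableAt ℝ h (L x)) (hC : ‖fderiv ℝ h (L x)‖ ≤ C) :
    ‖fderiv ℝ (fun y => h (L y)) x‖ ≤ C * ‖L‖ := by
  rw [fderiv_fun_comp x hh L.differentiableAt, L.fderiv]
  exact (ContinuousLinearMap.opNorm_comp_le _ _).trans (by gcongr)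

/-- `χ` is a smooth cutoff at scale `q`: it equals `1` on the ball of radius `q`, vanishes outside
the ball of radius `2q`, and has slope at most `D / q`. -/
structure IsCutoff {E : Type*} [NormedAddCommGroup E] [NormedSpace ℝ E] (D q : ℝ) (χ : E → ℝ) :
    Prop where
  contDiff : ContDiff ℝ ∞ χ
  mem_Icc : ∀ x, χ x ∈ Icc 0 1
  eq_one : ∀ x, ‖x‖ ≤ q → χ x = 1
  eq_zero : ∀ x, 2 * q ≤ ‖x‖ → χ x = 0
  norm_fderiv_le : ∀ x, ‖fderiv ℝ χ x‖ ≤ D / q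

theorem exists_isCutoff (E : Type*) [NormedAddCommGroup E] [NormedSpace ℝ E]
    [FiniteDimensional ℝ E] : ∃ D, 0 ≤ D ∧ ∀ q > 0, ∃ χ : E → ℝ, IsCutoff D q χ := by
  let b : ContDiffBump (0 : E) := ⟨1, 2, one_pos, one_lt_two⟩
  obtain ⟨D, hD⟩ := (b.hasCompactSupport.fderiv ℝ).exists_bound_of_continuous
    (b.contDiff.continuous_fderiv one_ne_zero)
  refine ⟨D, (norm_nonneg _).trans (hD 0), fun q hq => ⟨fun x => b (q⁻¹ • x), ?_⟩⟩
  have hnorm : ∀ x : E, ‖q⁻¹ • x‖ = ‖x‖ / q := fun x => by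
    rw [norm_smul, norm_inv, Real.norm_of_nonneg hq.le, inv_mul_eq_div]
  refine ⟨b.contDiff.comp (contDiff_const_smul _), fun x => ⟨b.nonneg, b.le_one⟩, fun x hx => ?_,
    fun x hx => ?_, fun x => ?_⟩
  · refine b.one_of_mem_closedBall (mem_closedBall_zero_iff.2 ?_)
    rwa [hnorm, div_le_one hq]
  · refine b.zero_of_le_dist ?_
    rwa [dist_zero_right, hnorm, le_div_iff₀ hq]
  · rw [fderiv_comp_smul, norm_smul, norm_inv, Real.norm_of_nonneg hq.le, inv_mul_eq_div]
    gcongr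
    exact hD _

namespace IsCutoff

variable {E : Type*} [NormedAddCommGroup E] [NormedSpace ℝ E] {D q : ℝ} {χ : E → ℝ}

theorem abs_le_one (hχ : IsCutoff D q χ) (x : E) : |χ x| ≤ 1 :=
  abs_le.2 ⟨by linarith [(hχ.mem_Icc x).1], (hχ.mem_Icc x).2⟩

theorem hasCompactSupport [FiniteDimensional ℝ E] (hχ : IsCutoff D q χ) : HasCompactSupport χ :=
  .intro (isCompact_closedBall 0 (2 * q)) fun x hx =>
    hχ.eq_zero x (le_of_lt (by simpa using hx))

end IsCutoff

theorem exists_hasCompactSupport_approx {E : Type*} [NormedAddCommGroup E] [NormedSpace ℝ E]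
    [FiniteDimensional ℝ E] {h : E → ℝ} {C C' : ℝ} (hh : ContDiff ℝ ∞ h)
    (hC : ∀ x, |h x| ≤ C) (hC' : ∀ x, ‖fderiv ℝ h x‖ ≤ C') :
    ∃ (g : ℕ → E → ℝ) (M : ℝ), (∀ n, ContDiff ℝ ∞ (g n)) ∧ (∀ n, HasCompactSupport (g n)) ∧
      (∀ n, tsupport (g n) ⊆ tsupport h) ∧ (∀ n x, |g n x| ≤ C) ∧
      (∀ n x, ‖fderiv ℝ (g n) x‖ ≤ M) ∧ ∀ x, ∀ᶠ n in atTop, g n =ᶠ[𝓝 x] h := by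
  obtain ⟨D, hD, hcutoff⟩ := exists_isCutoff E
  choose χ hχ using fun n : ℕ => hcutoff (n + 1) n.cast_add_one_pos
  refine ⟨fun n x => χ n x * h x, 1 * C' + C * D, fun n => (hχ n).contDiff.mul hh,
    fun n => (hχ n).hasCompactSupport.mul_right,
    fun n => closure_mono (Function.support_mul_subset_right _ _), fun n x => ?_, fun n x => ?_,
    fun x => ?_⟩
  · rw [abs_mul]
    exact (mul_le_of_le_one_left (abs_nonneg _) ((hχ n).abs_le_one x)).trans (hC x)
  · refine (norm_fderiv_mul_le ((hχ n).contDiff.differentiable (by simp) x)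
      (hh.differentiable (by simp) x) ((hχ n).abs_le_one x) ((hχ n).norm_fderiv_le x)
      (hC x) (hC' x)).trans ?_
    gcongr
    · exact (abs_nonneg _).trans (hC x)
    · exact div_le_self hD (by simp)
  · filter_upwards [eventually_gt_atTop ⌈‖x‖⌉₊] with n hn
    have hx : ‖x‖ < n + 1 := by linarith [Nat.lt_of_ceil_lt hn]
    filter_upwards [continuous_norm.continuousAt.preimage_mem_nhds (Iio_mem_nhds hx)] with y hy
    rw [(hχ n).eq_one y (le_of_lt hy), one_mul]

/-! ### The continuity equation -/

section Curve

variable {X Ω : Type*} [TopologicalSpace X] [TopologicalSpace Ω] [MeasurableSpace Ω]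
  {ρ : X → ProbabilityMeasure Ω}

theorem measurable_toMeasure_of_continuous [MeasurableSpace X] [OpensMeasurableSpace X]
    [BorelSpace Ω] [HasOuterApproxClosed Ω] (hρ : Continuous ρ) :
    Measurable fun x => (ρ x : Measure Ω) := by
  refine Measurable.measure_of_isPiSystem_of_isProbabilityMeasure
    (BorelSpace.measurable_eq (α := Ω)) isPiSystem_isOpen fun G hG => ?_
  refine LowerSemicontinuous.measurable ?_
  rw [lowerSemicontinuous_iff_le_liminf]
  exact fun x => ProbabilityMeasure.le_liminf_measure_open_of_tendsto (hρ.tendsto x) hG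

theorem stronglyMeasurable_integral_of_continuous [MeasurableSpace X] [OpensMeasurableSpace X]
    [BorelSpace Ω] [HasOuterApproxClosed Ω] {F : Type*} [NormedAddCommGroup F] [NormedSpace ℝ F]
    (hρ : Continuous ρ) {g : X → Ω → F} (hg : StronglyMeasurable (Function.uncurry g)) :
    StronglyMeasurable fun x => ∫ y, g x y ∂(ρ x : Measure Ω) := by
  let κ : Kernel X Ω := ⟨fun x => (ρ x : Measure Ω), measurable_toMeasure_of_continuous hρ⟩
  have : IsMarkovKernel κ := ⟨fun x => inferInstanceAs (IsProbabilityMeasure (ρ x : Measure Ω))⟩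
  exact StronglyMeasurable.integral_kernel_prod_right (κ := κ) hg

theorem continuous_integral_of_bounded [OpensMeasurableSpace Ω] (hρ : Continuous ρ) {h : Ω → ℝ}
    (hh : Continuous h) {C : ℝ} (hC : ∀ y, |h y| ≤ C) :
    Continuous fun x => ∫ y, h y ∂(ρ x : Measure Ω) :=
  (ProbabilityMeasure.continuous_integral_boundedContinuousFunction
    (BoundedContinuousFunction.ofNormedAddCommGroup h hh C hC)).comp hρ

end Curve

theorem tendsto_integral_of_eventually_eq {Ω : Type*} [MeasurableSpace Ω] {μ : Measure Ω}
    [IsFiniteMeasure μ] {F : ℕ → Ω → ℝ} {f : Ω → ℝ} {C : ℝ}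
    (hF : ∀ n, AEStronglyMeasurable (F n) μ) (hC : ∀ n x, ‖F n x‖ ≤ C)
    (hf : ∀ x, ∀ᶠ n in atTop, F n x = f x) :
    Tendsto (fun n => ∫ x, F n x ∂μ) atTop (𝓝 (∫ x, f x ∂μ)) :=
  tendsto_integral_of_dominated_convergence (fun _ => C) hF (integrable_const C)
    (fun n => .of_forall (hC n)) (.of_forall fun x => tendsto_nhds_of_eventually_eq (hf x))

theorem norm_fderiv_apply_le_of_mem_tsupport {E : Type*} [NormedAddCommGroup E] [NormedSpace ℝ E]
    {h : E → ℝ} {u θ : E} {b C' : ℝ} (hC' : ‖fderiv ℝ h θ‖ ≤ C')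
    (hu : θ ∈ tsupport h → ‖u‖ ≤ b) : ‖fderiv ℝ h θ u‖ ≤ C' * |b| := by
  by_cases hθ : θ ∈ tsupport h
  · exact (ContinuousLinearMap.le_opNorm _ _).trans (mul_le_mul hC' ((hu hθ).trans (le_abs_self b))
      (norm_nonneg _) ((norm_nonneg _).trans hC'))
  · rw [image_eq_zero_of_notMem_tsupport fun h' => hθ (tsupport_fderiv_subset ℝ h')]
    simpa using mul_nonneg ((norm_nonneg _).trans hC') (abs_nonneg b)

section ContinuityEquation

variable {E : Type*} [NormedAddCommGroup E] [NormedSpace ℝ E] [MeasurableSpace E]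

/-- The narrowly continuous curve `ρ` of probability measures is, on positive times, a weak
solution of the continuity equation `∂ₜρₜ + div (ρₜ vₜ) = 0`. It suffices to test with products
of a function of space and a function of time. -/
structure SolvesContinuityEquation [OpensMeasurableSpace E] (ρ : ℝ → ProbabilityMeasure E)
    (v : ℝ → E → E) : Prop where
  continuous : Continuous ρ
  measurable_velocity : Measurable (Function.uncurry v)
  weak : ∀ h : E → ℝ, ContDiff ℝ ∞ h → HasCompactSupport h →
    ∀ p : ℝ → ℝ, ContDiff ℝ ∞ p → HasCompactSupport p → tsupport p ⊆ Ioi 0 →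
      ∫ t in Ioi (0 : ℝ), ∫ θ, (deriv p t * h θ + p t * fderiv ℝ h θ (v t θ)) ∂(ρ t : Measure E) = 0

namespace SolvesContinuityEquation

variable [BorelSpace E] [FiniteDimensional ℝ E] {ρ : ℝ → ProbabilityMeasure E} {v : ℝ → E → E}
  {h : E → ℝ} {B : ℝ → ℝ} {C C' s t : ℝ}

theorem measurable_fderiv_velocity (hρ : SolvesContinuityEquation ρ v) (hh : ContDiff ℝ ∞ h) :
    Measurable (Function.uncurry fun t θ => fderiv ℝ h θ (v t θ)) := by
  have hcont : Continuous fun q : E × E => fderiv ℝ h q.1 q.2 :=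
    ((hh.continuous_fderiv (by simp)).comp continuous_fst).clm_apply continuous_snd
  exact hcont.measurable.comp (measurable_snd.prodMk hρ.measurable_velocity)

theorem stronglyMeasurable_integral_fderiv_velocity (hρ : SolvesContinuityEquation ρ v)
    (hh : ContDiff ℝ ∞ h) :
    StronglyMeasurable fun t => ∫ θ, fderiv ℝ h θ (v t θ) ∂(ρ t : Measure E) :=
  stronglyMeasurable_integral_of_continuous hρ.continuous
    (hρ.measurable_fderiv_velocity hh).stronglyMeasurable

theorem integral_sub_integral_of_hasCompactSupport (hρ : SolvesContinuityEquation ρ v)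
    (hh : ContDiff ℝ ∞ h) (hc : HasCompactSupport h) (hB : ∀ T, IntegrableOn B (Ioc 0 T))
    (hv : ∀ᵐ r ∂volume.restrict (Ioi (0 : ℝ)), ∀ θ ∈ tsupport h, ‖v r θ‖ ≤ B r)
    (hs : 0 ≤ s) (hst : s ≤ t) :
    (∫ θ, h θ ∂(ρ t : Measure E)) - ∫ θ, h θ ∂(ρ s : Measure E) =
      ∫ r in s..t, ∫ θ, fderiv ℝ h θ (v r θ) ∂(ρ r : Measure E) := by
  obtain ⟨C, hC⟩ := hh.continuous.bounded_above_of_compact_support hc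
  obtain ⟨C', hC'⟩ := (hh.continuous_fderiv (by simp)).bounded_above_of_compact_support
    (hc.fderiv (𝕜 := ℝ))
  have hbound : ∀ᵐ r ∂volume.restrict (Ioi (0 : ℝ)), ∀ θ, ‖fderiv ℝ h θ (v r θ)‖ ≤ C' * |B r| :=
    hv.mono fun r hr θ => norm_fderiv_apply_le_of_mem_tsupport (hC' θ) (hr θ)
  refine sub_eq_integral_of_weak_deriv (H := fun t => ∫ θ, h θ ∂(ρ t : Measure E))
    (continuous_integral_of_bounded hρ.continuous hh.continuous hC) (fun T => ?_)
    (fun p hp hpc hpt => ?_) hs hst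
  · refine ((hB T).abs.const_mul C').mono'
      (hρ.stronglyMeasurable_integral_fderiv_velocity hh).aestronglyMeasurable ?_
    filter_upwards [ae_restrict_of_ae_restrict_of_subset Ioc_subset_Ioi_self hbound] with r hr
    exact (norm_integral_le_of_norm_le_const (.of_forall hr)).trans (by simp)
  · refine (integral_congr_ae (hbound.mono fun r hr => ?_)).trans (hρ.weak h hh hc p hp hpc hpt)
    have hh_int : Integrable h (ρ r : Measure E) :=
      .of_bound hh.continuous.aestronglyMeasurable C (.of_forall hC)
    have hDh_int : Integrable (fun θ => fderiv ℝ h θ (v r θ)) (ρ r : Measure E) :=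
      .of_bound
        ((hρ.measurable_fderiv_velocity hh).comp measurable_prodMk_left).aestronglyMeasurable
        _ (.of_forall hr)
    symm
    rw [integral_add (hh_int.const_mul _) (hDh_int.const_mul _), integral_const_mul,
      integral_const_mul]

theorem integral_sub_integral (hρ : SolvesContinuityEquation ρ v)
    (hh : ContDiff ℝ ∞ h) (hC : ∀ θ, |h θ| ≤ C) (hC' : ∀ θ, ‖fderiv ℝ h θ‖ ≤ C')
    (hB : ∀ T, IntegrableOn B (Ioc 0 T))
    (hv : ∀ᵐ r ∂volume.restrict (Ioi (0 : ℝ)), ∀ θ ∈ tsupport h, ‖v r θ‖ ≤ B r)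
    (hs : 0 ≤ s) (hst : s ≤ t) :
    (∫ θ, h θ ∂(ρ t : Measure E)) - ∫ θ, h θ ∂(ρ s : Measure E) =
      ∫ r in s..t, ∫ θ, fderiv ℝ h θ (v r θ) ∂(ρ r : Measure E) := by
  obtain ⟨g, M, hg, hgc, hsupp, hgC, hDg, hgh⟩ := exists_hasCompactSupport_approx hh hC hC'
  have hDgv : ∀ᵐ r ∂volume.restrict (Ioi (0 : ℝ)), ∀ n θ,
      ‖fderiv ℝ (g n) θ (v r θ)‖ ≤ M * |B r| := hv.mono fun r hr n θ =>
    norm_fderiv_apply_le_of_mem_tsupport (hDg n θ) fun hθ => hr θ (hsupp n hθ)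
  have hlim : ∀ τ, Tendsto (fun n => ∫ θ, g n θ ∂(ρ τ : Measure E)) atTop
      (𝓝 (∫ θ, h θ ∂(ρ τ : Measure E))) := fun τ =>
    tendsto_integral_of_eventually_eq (fun n => (hg n).continuous.aestronglyMeasurable) hgC
      fun θ => (hgh θ).mono fun n hn => hn.eq_of_nhds
  have hlimD : ∀ᵐ r ∂volume.restrict (Ioi (0 : ℝ)), Tendsto
      (fun n => ∫ θ, fderiv ℝ (g n) θ (v r θ) ∂(ρ r : Measure E)) atTop
      (𝓝 (∫ θ, fderiv ℝ h θ (v r θ) ∂(ρ r : Measure E))) := hDgv.mono fun r hr =>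
    tendsto_integral_of_eventually_eq (fun n => ((hρ.measurable_fderiv_velocity (hg n)).comp
      measurable_prodMk_left).aestronglyMeasurable) hr
      fun θ => (hgh θ).mono fun n hn => by rw [hn.fderiv_eq]
  refine tendsto_nhds_unique (((hlim t).sub (hlim s)).congr fun n =>
    hρ.integral_sub_integral_of_hasCompactSupport (hg n) (hgc n) hB
      (hv.mono fun r hr θ hθ => hr θ (hsupp n hθ)) hs hst) ?_
  have hsub : uIoc s t ⊆ Ioi 0 := fun r hr => by
    rw [uIoc_of_le hst] at hr; exact hs.trans_lt hr.1
  refine intervalIntegral.tendsto_integral_filter_of_dominated_convergence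
    (fun r => M * |B r|) (.of_forall fun n =>
      (hρ.stronglyMeasurable_integral_fderiv_velocity (hg n)).aestronglyMeasurable)
    (.of_forall fun n => ?_) ?_ ?_
  · filter_upwards [(ae_restrict_iff' measurableSet_Ioi).1 hDgv] with r hr hmem
    exact (norm_integral_le_of_norm_le_const (.of_forall (hr (hsub hmem) n))).trans (by simp)
  · rw [intervalIntegrable_iff, uIoc_of_le hst]
    exact ((hB t).mono_set (Ioc_subset_Ioc_left hs)).abs.const_mul _
  · filter_upwards [(ae_restrict_iff' measurableSet_Ioi).1 hlimD] with r hr hmem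
    exact hr (hsub hmem)

end SolvesContinuityEquation

end ContinuityEquation

section CutoffExp

variable {E : Type*} [NormedAddCommGroup E] [NormedSpace ℝ E] {D q : ℝ} {χ : ℝ → ℝ}

namespace IsCutoff

theorem tsupport_sub_subset (hχ : IsCutoff D q χ) (ℓ : E →L[ℝ] ℝ) {g : E → ℝ} {a : ℝ}
    (hg : ∀ θ, χ (ℓ θ) = 0 → g θ = a) :
    tsupport (fun θ => g θ - a) ⊆ {θ | |ℓ θ| ≤ 2 * q} := by
  refine closure_minimal (fun θ hθ => ?_) (isClosed_le (by fun_prop) continuous_const)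
  by_contra hlt
  exact hθ (sub_eq_zero.2 (hg θ (hχ.eq_zero (ℓ θ) (not_le.1 hlt).le)))

theorem contDiff_exp (hχ : IsCutoff D q χ) (ℓ : E →L[ℝ] ℝ) (n : ℕ) :
    ContDiff ℝ ∞ fun θ => Real.exp (-(n * χ (ℓ θ))) :=
  ((contDiff_const.mul (hχ.contDiff.comp ℓ.contDiff)).neg).exp

theorem exp_le_one (hχ : IsCutoff D q χ) (n : ℕ) (x : ℝ) : Real.exp (-(n * χ x)) ≤ 1 :=
  Real.exp_le_one_iff.2 (neg_nonpos.2 (mul_nonneg n.cast_nonneg (hχ.mem_Icc _).1))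

theorem abs_fderiv_exp_apply_le (hχ : IsCutoff D q χ) (ℓ : E →L[ℝ] ℝ) (n : ℕ) (θ u : E) :
    |fderiv ℝ (fun θ => Real.exp (-(n * χ (ℓ θ)))) θ u| ≤
      n * (D / q) * |ℓ u| * Real.exp (-(n * χ (ℓ θ))) := by
  have hderiv : HasFDerivAt (fun θ => Real.exp (-(n * χ (ℓ θ))))
      (Real.exp (-(n * χ (ℓ θ))) • -((n : ℝ) • (fderiv ℝ χ (ℓ θ)).comp ℓ)) θ :=
    ((((hχ.contDiff.differentiable (by simp) (ℓ θ)).hasFDerivAt.comp θ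
      ℓ.hasFDerivAt).const_mul (n : ℝ)).neg).exp
  have hχu : |fderiv ℝ χ (ℓ θ) (ℓ u)| ≤ D / q * |ℓ u| :=
    (fderiv ℝ χ (ℓ θ)).le_of_opNorm_le (hχ.norm_fderiv_le _) _
  rw [hderiv.fderiv]
  simp only [_root_.smul_apply, _root_.neg_apply, ContinuousLinearMap.comp_apply, smul_eq_mul,
    abs_mul, abs_neg, Real.abs_exp, Nat.abs_cast]
  rw [mul_comm, mul_assoc (n : ℝ) (D / q)]
  gcongr

theorem integrable_exp [MeasurableSpace E] [OpensMeasurableSpace E] {μ : Measure E}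
    [IsFiniteMeasure μ] (hχ : IsCutoff D q χ) (ℓ : E →L[ℝ] ℝ) (n : ℕ) :
    Integrable (fun θ => Real.exp (-(n * χ (ℓ θ)))) μ :=
  .of_bound (hχ.contDiff_exp ℓ n).continuous.aestronglyMeasurable 1 (.of_forall fun θ => by
    rw [Real.norm_of_nonneg (Real.exp_nonneg _)]
    exact hχ.exp_le_one n _)

theorem measureReal_le_integral_exp [MeasurableSpace E] [OpensMeasurableSpace E] {μ : Measure E}
    [IsFiniteMeasure μ] (hχ : IsCutoff D q χ) (ℓ : E →L[ℝ] ℝ) (n : ℕ) :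
    μ.real {θ | 2 * q < |ℓ θ|} ≤ ∫ θ, Real.exp (-(n * χ (ℓ θ))) ∂μ := by
  refine le_trans ?_ (mul_meas_ge_le_integral_of_nonneg
    (.of_forall fun θ => Real.exp_nonneg _) (hχ.integrable_exp ℓ n) 1)
  rw [one_mul]
  exact measureReal_mono fun θ hθ => by simp [hχ.eq_zero (ℓ θ) (le_of_lt hθ)]

end IsCutoff

end CutoffExp

namespace SolvesContinuityEquation

variable {E : Type*} [NormedAddCommGroup E] [NormedSpace ℝ E] [MeasurableSpace E] [BorelSpace E]
  [FiniteDimensional ℝ E] {ρ : ℝ → ProbabilityMeasure E} {v : ℝ → E → E} {ℓ : E →L[ℝ] ℝ}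

theorem integral_le_mul_exp (hρ : SolvesContinuityEquation ρ v) {g : E → ℝ} {B c : ℝ → ℝ}
    {C C' t : ℝ} (a : ℝ) (hg : ContDiff ℝ ∞ g) (hC : ∀ θ, |g θ| ≤ C)
    (hC' : ∀ θ, ‖fderiv ℝ g θ‖ ≤ C') (hB : ∀ T, IntegrableOn B (Ioc 0 T))
    (hv : ∀ᵐ r ∂volume.restrict (Ioi (0 : ℝ)), ∀ θ ∈ tsupport (fun θ => g θ - a), ‖v r θ‖ ≤ B r)
    (ht : 0 ≤ t) (hc : IntegrableOn c (Ioc 0 t)) (hc0 : ∀ r, 0 ≤ c r)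
    (hrate : ∀ᵐ r ∂volume.restrict (Ioc 0 t),
      ∫ θ, fderiv ℝ g θ (v r θ) ∂(ρ r : Measure E) ≤ c r * ∫ θ, g θ ∂(ρ r : Measure E)) :
    ∫ θ, g θ ∂(ρ t : Measure E) ≤
      (∫ θ, g θ ∂(ρ 0 : Measure E)) * Real.exp (∫ r in (0 : ℝ)..t, c r) := by
  let F : ℝ → ℝ := fun r => ∫ θ, g θ ∂(ρ r : Measure E)
  let F' : ℝ → ℝ := fun r => ∫ θ, fderiv ℝ g θ (v r θ) ∂(ρ r : Measure E)
  have hF : Continuous F := continuous_integral_of_bounded hρ.continuous hg.continuous hC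
  have hgint : ∀ r, Integrable g (ρ r : Measure E) := fun r =>
    .of_bound hg.continuous.aestronglyMeasurable C (.of_forall hC)
  have hF' : ∀ τ, 0 ≤ τ → F τ - F 0 = ∫ r in (0 : ℝ)..τ, F' r := by
    intro τ hτ
    have hbal := hρ.integral_sub_integral (h := fun θ => g θ - a) (hg.sub contDiff_const)
      (C := C + |a|) (fun θ => (abs_sub _ _).trans (by gcongr; exact hC θ))
      (C' := C') (fun θ => by rw [fderiv_sub_const]; exact hC' θ) hB hv le_rfl hτ
    simpa [fderiv_sub_const, integral_sub (hgint _) (integrable_const a), F, F'] using hbal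
  have hF'int : IntegrableOn F' (Ioc 0 t) := by
    refine ((hB t).abs.const_mul C').mono'
      (hρ.stronglyMeasurable_integral_fderiv_velocity hg).aestronglyMeasurable ?_
    filter_upwards [ae_restrict_of_ae_restrict_of_subset Ioc_subset_Ioi_self hv] with r hr
    refine (norm_integral_le_of_norm_le_const (C := C' * |B r|) (.of_forall fun θ => ?_)).trans
      (by simp)
    simpa [fderiv_sub_const] using norm_fderiv_apply_le_of_mem_tsupport (C' := C')
      (by rw [fderiv_sub_const]; exact hC' θ) (hr θ)
  have hcF : IntegrableOn (fun r => c r * F r) (Ioc 0 t) :=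
    (((integrableOn_Icc_iff_integrableOn_Ioc).2 hc).mul_continuousOn hF.continuousOn
      isCompact_Icc).mono_set Ioc_subset_Icc_self
  refine le_mul_exp_of_le_add_integral (F := F) ht
    ((intervalIntegrable_iff_integrableOn_Ioc_of_le ht).2 hc) (fun r _ => hc0 r) hF.continuousOn
    fun τ hτ => ?_
  have hsub : Ioc 0 τ ⊆ Ioc 0 t := Ioc_subset_Ioc_right hτ.2
  have hmono : ∫ r in (0 : ℝ)..τ, F' r ≤ ∫ r in (0 : ℝ)..τ, c r * F r := by
    rw [intervalIntegral.integral_of_le hτ.1, intervalIntegral.integral_of_le hτ.1]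
    exact integral_mono_ae (hF'int.mono_set hsub) (hcF.mono_set hsub)
      (ae_restrict_of_ae_restrict_of_subset hsub hrate)
  linarith [hF' τ hτ.1]

/-- Since `exp (-n χ)` is `exp (-n)` where `χ = 1` and `1` where `χ = 0`, its integral against
`ρ t` becomes small only if `ρ t` charges the set `χ = 0` little. -/
theorem integral_exp_cutoff_le (hρ : SolvesContinuityEquation ρ v) {B B' : ℝ → ℝ} {D q t : ℝ}
    {χ : ℝ → ℝ} (hχ : IsCutoff D q χ) (hD : 0 ≤ D) (hq : 0 < q)
    (hB0 : ∀ r, 0 ≤ B r) (hB : ∀ T, IntegrableOn B (Ioc 0 T))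
    (hB' : ∀ T, IntegrableOn B' (Ioc 0 T))
    (hℓ : ∀ᵐ r ∂volume.restrict (Ioi (0 : ℝ)), ∀ θ, |ℓ (v r θ)| ≤ B r)
    (hv : ∀ᵐ r ∂volume.restrict (Ioi (0 : ℝ)), ∀ θ, |ℓ θ| ≤ 2 * q → ‖v r θ‖ ≤ B' r)
    (h0 : ∀ᵐ θ ∂(ρ 0 : Measure E), |ℓ θ| ≤ q) (ht : 0 ≤ t) (n : ℕ) :
    ∫ θ, Real.exp (-(n * χ (ℓ θ))) ∂(ρ t : Measure E) ≤
      Real.exp (-n) * Real.exp (∫ r in (0 : ℝ)..t, n * (D / q) * B r) := by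
  have hsupp : tsupport (fun θ => Real.exp (-(n * χ (ℓ θ))) - 1) ⊆ {θ | |ℓ θ| ≤ 2 * q} :=
    hχ.tsupport_sub_subset ℓ fun θ hθ => by simp [hθ]
  have hbound : ∀ θ, |Real.exp (-(n * χ (ℓ θ)))| ≤ 1 := fun θ => by
    rw [Real.abs_exp]
    exact hχ.exp_le_one n _
  have hinit : ∫ θ, Real.exp (-(n * χ (ℓ θ))) ∂(ρ 0 : Measure E) = Real.exp (-n) := by
    rw [integral_congr_ae (h0.mono fun θ hθ => by
      simp only [hχ.eq_one (ℓ θ) hθ, mul_one] : _ =ᵐ[_] fun _ => Real.exp (-n))]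
    simp
  rw [← hinit]
  refine hρ.integral_le_mul_exp (C := 1) (C' := n * (D / q) * ‖ℓ‖) 1 (hχ.contDiff_exp ℓ n)
    hbound (fun θ => ?_) hB' (hv.mono fun r hr θ hθ => hr θ (hsupp hθ)) ht ((hB t).const_mul _)
    (fun r => mul_nonneg (by positivity) (hB0 r)) ?_
  · refine ContinuousLinearMap.opNorm_le_bound _ (by positivity) fun u => ?_
    refine (hχ.abs_fderiv_exp_apply_le ℓ n θ u).trans
      ((mul_le_of_le_one_right (by positivity) (hχ.exp_le_one n _)).trans ?_)
    rw [mul_assoc _ ‖ℓ‖]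
    gcongr
    exact ℓ.le_opNorm u
  · filter_upwards [ae_restrict_of_ae_restrict_of_subset Ioc_subset_Ioi_self hℓ] with r hr
    rw [← integral_const_mul]
    refine (Real.le_norm_self _).trans (norm_integral_le_of_norm_le
      ((hχ.integrable_exp ℓ n).const_mul _) (.of_forall fun θ =>
        (hχ.abs_fderiv_exp_apply_le ℓ n θ _).trans ?_))
    gcongr
    exact hr θ

theorem exists_forall_ae_abs_le (hρ : SolvesContinuityEquation ρ v) {B : ℝ → ℝ} {K : ℝ}
    (hB0 : ∀ r, 0 ≤ B r) (hB : ∀ T, IntegrableOn B (Ioc 0 T))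
    (hℓ : ∀ᵐ r ∂volume.restrict (Ioi (0 : ℝ)), ∀ θ, |ℓ (v r θ)| ≤ B r)
    (hv : ∀ R : ℝ, ∃ B' : ℝ → ℝ, (∀ T, IntegrableOn B' (Ioc 0 T)) ∧
      ∀ᵐ r ∂volume.restrict (Ioi (0 : ℝ)), ∀ θ, |ℓ θ| ≤ R → ‖v r θ‖ ≤ B' r)
    (h0 : ∀ᵐ θ ∂(ρ 0 : Measure E), |ℓ θ| ≤ K) (T : ℝ) :
    ∃ R, ∀ t ∈ Icc 0 T, ∀ᵐ θ ∂(ρ t : Measure E), |ℓ θ| ≤ R := by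
  let I : ℝ := ∫ r in Ioc 0 T, B r
  obtain ⟨D, hD, hcutoff⟩ := exists_isCutoff ℝ
  have hI : 0 ≤ I := setIntegral_nonneg measurableSet_Ioc fun r _ => hB0 r
  let q : ℝ := |K| + 1 + 2 * D * I
  have hq : 0 < q := by positivity
  obtain ⟨χ, hχ⟩ := hcutoff q hq
  obtain ⟨B', hB', hvB'⟩ := hv (2 * q)
  refine ⟨2 * q, fun t ht => ?_⟩
  have hexp : ∀ n : ℕ, ∫ θ, Real.exp (-(n * χ (ℓ θ))) ∂(ρ t : Measure E) ≤
      Real.exp (-(1 / 2)) ^ n := by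
    intro n
    refine (hρ.integral_exp_cutoff_le hχ hD hq hB0 hB hB' hℓ hvB' (h0.mono fun θ hθ => ?_)
      ht.1 n).trans ?_
    · have : 0 ≤ D * I := by positivity
      linarith [le_abs_self K, show q = |K| + 1 + 2 * D * I from rfl]
    · have hIt : ∫ r in (0 : ℝ)..t, B r ≤ I := by
        rw [intervalIntegral.integral_of_le ht.1]
        exact setIntegral_mono_set (hB T) (.of_forall hB0)
          (Ioc_subset_Ioc_right ht.2).eventuallyLE
      have hDI : D / q * ∫ r in (0 : ℝ)..t, B r ≤ 1 / 2 := by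
        rw [div_mul_eq_mul_div, div_le_iff₀ hq]
        have := mul_le_mul_of_nonneg_left hIt hD
        linarith [abs_nonneg K, show q = |K| + 1 + 2 * D * I from rfl]
      rw [← Real.exp_add, ← Real.exp_nat_mul, intervalIntegral.integral_const_mul]
      refine Real.exp_le_exp.2 ?_
      nlinarith [mul_le_mul_of_nonneg_left hDI (Nat.cast_nonneg (α := ℝ) n)]
  have hmass : ∀ n : ℕ, (ρ t : Measure E).real {θ | 2 * q < |ℓ θ|} ≤ Real.exp (-(1 / 2)) ^ n :=
    fun n => (hχ.measureReal_le_integral_exp ℓ n).trans (hexp n)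
  have hzero := ge_of_tendsto' (tendsto_pow_atTop_nhds_zero_of_lt_one (Real.exp_nonneg _)
    (by simp)) hmass
  rw [ae_iff]
  simpa [measureReal_eq_zero_iff] using hzero.antisymm measureReal_nonneg

end SolvesContinuityEquation

/-- The saturated square `‖y‖² / (1 + ‖y‖²)`: a bounded smooth function with bounded derivative
that vanishes only at `0`, and quadratically so. -/
def saturatedSq {F : Type*} [Norm F] (y : F) : ℝ :=
  1 - (1 + ‖y‖ ^ 2)⁻¹

section SaturatedSq

variable {F : Type*} [NormedAddCommGroup F]

theorem saturatedSq_mul (y : F) : saturatedSq y * (1 + ‖y‖ ^ 2) = ‖y‖ ^ 2 := by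
  have : 0 < 1 + ‖y‖ ^ 2 := by positivity
  rw [saturatedSq]
  field_simp
  ring

theorem saturatedSq_nonneg (y : F) : 0 ≤ saturatedSq y :=
  nonneg_of_mul_nonneg_left ((sq_nonneg ‖y‖).trans_eq (saturatedSq_mul y).symm) (by positivity)

theorem abs_saturatedSq_le_one (y : F) : |saturatedSq y| ≤ 1 := by
  rw [abs_of_nonneg (saturatedSq_nonneg y), saturatedSq, sub_le_self_iff]
  positivity

theorem saturatedSq_eq_zero {y : F} : saturatedSq y = 0 ↔ y = 0 := by
  refine ⟨fun h => ?_, fun h => by simp [saturatedSq, h]⟩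
  simpa [h] using (saturatedSq_mul y).symm

theorem sq_min_one_norm_le (y : F) : min 1 ‖y‖ ^ 2 ≤ 2 * saturatedSq y := by
  have hmul := saturatedSq_mul y
  rcases le_total 1 ‖y‖ with h | h
  · rw [min_eq_left h]
    nlinarith [saturatedSq_nonneg y]
  · rw [min_eq_right h]
    nlinarith [saturatedSq_nonneg y, pow_le_one₀ (n := 2) (norm_nonneg y) h]

variable [InnerProductSpace ℝ F]

theorem contDiff_saturatedSq : ContDiff ℝ ∞ (saturatedSq : F → ℝ) :=
  contDiff_const.sub ((contDiff_const.add (contDiff_norm_sq ℝ)).inv fun y => by positivity)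

theorem fderiv_saturatedSq_apply (y z : F) :
    fderiv ℝ saturatedSq y z = ((1 + ‖y‖ ^ 2) ^ 2)⁻¹ * (2 * inner ℝ y z) := by
  have hpos : 0 < 1 + ‖y‖ ^ 2 := by positivity
  have hsq : HasFDerivAt (fun y : F => ‖y‖ ^ 2) _ y := (hasFDerivAt_id y).norm_sq
  have hsat : HasFDerivAt (saturatedSq : F → ℝ) _ y :=
    ((hasDerivAt_inv hpos.ne').comp_hasFDerivAt y (hsq.const_add 1)).const_sub 1
  rw [hsat.fderiv]
  simp

theorem norm_fderiv_saturatedSq_le (y : F) : ‖fderiv ℝ saturatedSq y‖ ≤ 2 := by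
  refine ContinuousLinearMap.opNorm_le_bound _ zero_le_two fun z => ?_
  rw [fderiv_saturatedSq_apply, norm_mul, Real.norm_of_nonneg (by positivity),
    inv_mul_le_iff₀ (by positivity), norm_mul, Real.norm_two]
  have hy : ‖y‖ ≤ (1 + ‖y‖ ^ 2) ^ 2 := by nlinarith [sq_nonneg (‖y‖ - 1), sq_nonneg (‖y‖ ^ 2)]
  calc 2 * ‖inner ℝ y z‖ ≤ 2 * (‖y‖ * ‖z‖) := by gcongr; exact norm_inner_le_norm y z
    _ ≤ 2 * ((1 + ‖y‖ ^ 2) ^ 2 * ‖z‖) := by gcongr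
    _ = (1 + ‖y‖ ^ 2) ^ 2 * (2 * ‖z‖) := by ring

theorem abs_fderiv_saturatedSq_apply_le {y z : F} {C m : ℝ} (hC : 0 ≤ C)
    (hz : ‖z‖ ≤ C * (‖y‖ + m)) :
    |fderiv ℝ saturatedSq y z| ≤ 2 * C * (2 * saturatedSq y + m ^ 2) := by
  rw [fderiv_saturatedSq_apply, abs_mul, abs_of_nonneg (by positivity),
    inv_mul_le_iff₀ (by positivity), abs_mul, abs_two]
  have hsat : (1 + ‖y‖ ^ 2) ^ 2 * (2 * saturatedSq y) = (1 + ‖y‖ ^ 2) * (2 * ‖y‖ ^ 2) := by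
    linear_combination (2 * (1 + ‖y‖ ^ 2)) * saturatedSq_mul y
  have hpoly : ‖y‖ * (‖y‖ + m) ≤ (1 + ‖y‖ ^ 2) ^ 2 * (2 * saturatedSq y + m ^ 2) := by
    rw [mul_add ((1 + ‖y‖ ^ 2) ^ 2), hsat]
    nlinarith [sq_nonneg (‖y‖ - m), sq_nonneg (‖y‖ * m), sq_nonneg (‖y‖ ^ 2 * m),
      sq_nonneg (‖y‖ ^ 2), sq_nonneg ‖y‖, sq_nonneg m]
  calc 2 * |inner ℝ y z| ≤ 2 * (‖y‖ * (C * (‖y‖ + m))) := by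
        gcongr
        exact (abs_real_inner_le_norm y z).trans (by gcongr)
    _ = 2 * C * (‖y‖ * (‖y‖ + m)) := by ring
    _ ≤ 2 * C * ((1 + ‖y‖ ^ 2) ^ 2 * (2 * saturatedSq y + m ^ 2)) := by gcongr
    _ = _ := by ring

theorem integrable_saturatedSq_comp {Ω : Type*} [MeasurableSpace Ω] {μ : Measure Ω}
    [IsFiniteMeasure μ] {f : Ω → F} (hf : AEStronglyMeasurable f μ) :
    Integrable (fun x => saturatedSq (f x)) μ :=
  .of_bound (contDiff_saturatedSq.continuous.comp_aestronglyMeasurable hf) 1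
    (.of_forall fun x => abs_saturatedSq_le_one (f x))

theorem sq_integral_min_one_norm_le {Ω : Type*} [MeasurableSpace Ω] {μ : Measure Ω}
    [IsProbabilityMeasure μ] {f : Ω → F} (hf : AEStronglyMeasurable f μ) :
    (∫ x, min 1 ‖f x‖ ∂μ) ^ 2 ≤ 2 * ∫ x, saturatedSq (f x) ∂μ := by
  have hle : ∀ x, ‖min 1 ‖f x‖‖ ≤ 1 := fun x => by
    rw [Real.norm_of_nonneg (le_min zero_le_one (norm_nonneg _))]
    exact min_le_left _ _
  have hmeas : AEStronglyMeasurable (fun x => min 1 ‖f x‖) μ :=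
    aestronglyMeasurable_const.inf hf.norm
  have hsq : Integrable (fun x => min 1 ‖f x‖ ^ 2) μ :=
    .of_bound (hmeas.pow 2) 1 (.of_forall fun x => by
      rw [norm_pow]
      exact pow_le_one₀ (norm_nonneg _) (hle x))
  calc (∫ x, min 1 ‖f x‖ ∂μ) ^ 2 ≤ ∫ x, min 1 ‖f x‖ ^ 2 ∂μ :=
        even_two.convexOn_pow.map_integral_le (continuous_pow 2).continuousOn isClosed_univ
          (.of_forall fun _ => mem_univ _) (.of_bound hmeas 1 (.of_forall hle)) hsq
    _ ≤ ∫ x, 2 * saturatedSq (f x) ∂μ :=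
        integral_mono hsq ((integrable_saturatedSq_comp hf).const_mul 2)
          fun x => sq_min_one_norm_le (f x)
    _ = _ := integral_const_mul _ _

end SaturatedSq

namespace IsCutoff

variable {E : Type*} [NormedAddCommGroup E] [NormedSpace ℝ E] {F : Type*} [NormedAddCommGroup F]
  [InnerProductSpace ℝ F] {D q : ℝ} {χ : ℝ → ℝ}

theorem contDiff_mul_saturatedSq (hχ : IsCutoff D q χ) (ℓ : E →L[ℝ] ℝ) (P : E →L[ℝ] F) :
    ContDiff ℝ ∞ fun θ => χ (ℓ θ) * saturatedSq (P θ) :=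
  (hχ.contDiff.comp ℓ.contDiff).mul (contDiff_saturatedSq.comp P.contDiff)

theorem abs_mul_saturatedSq_le_one (hχ : IsCutoff D q χ) (ℓ : E →L[ℝ] ℝ) (P : E →L[ℝ] F)
    (θ : E) : |χ (ℓ θ) * saturatedSq (P θ)| ≤ 1 := by
  rw [abs_mul]
  exact mul_le_one₀ (hχ.abs_le_one _) (abs_nonneg _) (abs_saturatedSq_le_one _)

theorem norm_fderiv_mul_saturatedSq_le (hχ : IsCutoff D q χ) (ℓ : E →L[ℝ] ℝ) (P : E →L[ℝ] F)
    (θ : E) :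
    ‖fderiv ℝ (fun θ => χ (ℓ θ) * saturatedSq (P θ)) θ‖ ≤
      1 * (2 * ‖P‖) + 1 * (D / q * ‖ℓ‖) := by
  have hχd := hχ.contDiff.differentiable (by simp) (ℓ θ)
  have hsat := (contDiff_saturatedSq (F := F)).differentiable (by simp) (P θ)
  exact norm_fderiv_mul_le (hχd.comp θ ℓ.differentiableAt) (hsat.comp θ P.differentiableAt)
    (hχ.abs_le_one _) (norm_fderiv_comp_le ℓ hχd (hχ.norm_fderiv_le _))
    (abs_saturatedSq_le_one _) (norm_fderiv_comp_le P hsat (norm_fderiv_saturatedSq_le _))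

end IsCutoff

namespace SolvesContinuityEquation

variable {E : Type*} [NormedAddCommGroup E] [NormedSpace ℝ E] [MeasurableSpace E] [BorelSpace E]
  [FiniteDimensional ℝ E] {ρ : ℝ → ProbabilityMeasure E} {v : ℝ → E → E} {ℓ : E →L[ℝ] ℝ}
  {F : Type*} [NormedAddCommGroup F] [InnerProductSpace ℝ F] {P : E →L[ℝ] F}

theorem integral_fderiv_cutoff_mul_saturatedSq_le {D q R C : ℝ} {χ : ℝ → ℝ}
    (hχ : IsCutoff D q χ) (hRq : R < q) (hC : 0 ≤ C) {μ : Measure E} [IsProbabilityMeasure μ]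
    {u : E → E} (hR : ∀ᵐ θ ∂μ, |ℓ θ| ≤ R)
    (hu : ∀ θ, |ℓ θ| ≤ R → ‖P (u θ)‖ ≤ C * (‖P θ‖ + ∫ θ', min 1 ‖P θ'‖ ∂μ)) :
    ∫ θ, fderiv ℝ (fun θ => χ (ℓ θ) * saturatedSq (P θ)) θ (u θ) ∂μ ≤
      8 * C * ∫ θ, χ (ℓ θ) * saturatedSq (P θ) ∂μ := by
  have hP : AEStronglyMeasurable P μ := P.continuous.aestronglyMeasurable
  let m : ℝ := ∫ θ, min 1 ‖P θ‖ ∂μ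
  have hχ_one : ∀ θ, |ℓ θ| ≤ R → ∀ᶠ θ' in 𝓝 θ, χ (ℓ θ') = 1 := fun θ hθ => by
    filter_upwards [ℓ.continuous.abs.continuousAt.preimage_mem_nhds
      (Iio_mem_nhds (hθ.trans_lt hRq))] with θ' hθ'
    exact hχ.eq_one _ (le_of_lt hθ')
  have hpoint : ∀ᵐ θ ∂μ, ‖fderiv ℝ (fun θ => χ (ℓ θ) * saturatedSq (P θ)) θ (u θ)‖ ≤
      2 * C * (2 * saturatedSq (P θ) + m ^ 2) := hR.mono fun θ hθ => by
    have hloc : (fun θ => χ (ℓ θ) * saturatedSq (P θ)) =ᶠ[𝓝 θ] saturatedSq ∘ P :=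
      (hχ_one θ hθ).mono fun θ' hθ' => by simp [hθ']
    rw [hloc.fderiv_eq, fderiv_comp θ (contDiff_saturatedSq.differentiable (by simp) _)
      P.differentiableAt, P.fderiv]
    exact abs_fderiv_saturatedSq_apply_le hC (hu θ hθ)
  have hcut : ∫ θ, χ (ℓ θ) * saturatedSq (P θ) ∂μ = ∫ θ, saturatedSq (P θ) ∂μ :=
    integral_congr_ae (hR.mono fun θ hθ => by simp [(hχ_one θ hθ).self_of_nhds])
  rw [hcut]
  calc _ ≤ ∫ θ, 2 * C * (2 * saturatedSq (P θ) + m ^ 2) ∂μ :=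
        (Real.le_norm_self _).trans (norm_integral_le_of_norm_le
          ((((integrable_saturatedSq_comp hP).const_mul 2).add (integrable_const _)).const_mul _)
          hpoint)
    _ = 2 * C * (2 * ∫ θ, saturatedSq (P θ) ∂μ + m ^ 2) := by
        rw [integral_const_mul, integral_add ((integrable_saturatedSq_comp hP).const_mul 2)
          (integrable_const _), integral_const_mul]
        simp
    _ ≤ 2 * C * (2 * ∫ θ, saturatedSq (P θ) ∂μ + 2 * ∫ θ, saturatedSq (P θ) ∂μ) := by
        gcongr
        exact sq_integral_min_one_norm_le hP
    _ = _ := by ring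

theorem ae_apply_eq_zero (hρ : SolvesContinuityEquation ρ v) {T R C : ℝ} (hT : 0 ≤ T) (hC : 0 ≤ C)
    (hR : ∀ t ∈ Icc 0 T, ∀ᵐ θ ∂(ρ t : Measure E), |ℓ θ| ≤ R)
    (hv : ∀ R : ℝ, ∃ B : ℝ → ℝ, (∀ T, IntegrableOn B (Ioc 0 T)) ∧
      ∀ᵐ r ∂volume.restrict (Ioi (0 : ℝ)), ∀ θ, |ℓ θ| ≤ R → ‖v r θ‖ ≤ B r)
    (hP : ∀ᵐ r ∂volume.restrict (Ioc 0 T), ∀ θ, |ℓ θ| ≤ R →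
      ‖P (v r θ)‖ ≤ C * (‖P θ‖ + ∫ θ', min 1 ‖P θ'‖ ∂(ρ r : Measure E)))
    (h0 : ∀ᵐ θ ∂(ρ 0 : Measure E), P θ = 0) : ∀ᵐ θ ∂(ρ T : Measure E), P θ = 0 := by
  obtain ⟨D, -, hcutoff⟩ := exists_isCutoff ℝ
  let q : ℝ := |R| + 1
  obtain ⟨χ, hχ⟩ := hcutoff q (by positivity)
  obtain ⟨B, hB, hvB⟩ := hv (2 * q)
  let g : E → ℝ := fun θ => χ (ℓ θ) * saturatedSq (P θ)
  have hg : ContDiff ℝ ∞ g := hχ.contDiff_mul_saturatedSq ℓ P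
  have hg0 : ∀ θ, 0 ≤ g θ := fun θ => mul_nonneg (hχ.mem_Icc _).1 (saturatedSq_nonneg _)
  have hsupp : tsupport (fun θ => g θ - 0) ⊆ {θ | |ℓ θ| ≤ 2 * q} :=
    hχ.tsupport_sub_subset ℓ fun θ hθ => by simp [g, hθ]
  have hgint : ∫ θ, g θ ∂(ρ T : Measure E) ≤ 0 := by
    refine (hρ.integral_le_mul_exp (c := fun _ => 8 * C) 0 hg
      (hχ.abs_mul_saturatedSq_le_one ℓ P) (hχ.norm_fderiv_mul_saturatedSq_le ℓ P) hB
      (hvB.mono fun r hr θ hθ => hr θ (hsupp hθ)) hT (integrable_const _)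
      (fun _ => by positivity) ?_).trans_eq ?_
    · filter_upwards [hP, ae_restrict_mem measurableSet_Ioc] with r hr hrT
      exact integral_fderiv_cutoff_mul_saturatedSq_le hχ
        ((le_abs_self R).trans_lt (lt_add_one _)) hC (hR r (Ioc_subset_Icc_self hrT)) hr
    · rw [integral_eq_zero_of_ae (h0.mono fun θ hθ => by
        simp [g, saturatedSq_eq_zero.2 hθ]), zero_mul]
  have hg_ae : g =ᵐ[(ρ T : Measure E)] 0 := (integral_eq_zero_iff_of_nonneg hg0
    (.of_bound hg.continuous.aestronglyMeasurable 1
      (.of_forall (hχ.abs_mul_saturatedSq_le_one ℓ P)))).1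
    (hgint.antisymm (integral_nonneg hg0))
  filter_upwards [hg_ae, hR T ⟨hT, le_rfl⟩] with θ hgθ hθ
  have hχθ : χ (ℓ θ) = 1 :=
    hχ.eq_one _ (hθ.trans ((le_abs_self R).trans (le_add_of_nonneg_right zero_le_one)))
  exact saturatedSq_eq_zero.1 (by simpa [g, hχθ] using hgθ)

end SolvesContinuityEquation

/-! ### Correlation with a ridge function -/

/-- A bounded function of class `C^{1,1}` on the line: one constant `K` bounds the function, its
derivative and the Lipschitz constant of the derivative. -/
structure IsBoundedC11 (σ : ℝ → ℝ) (K : ℝ) : Prop where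
  differentiable : Differentiable ℝ σ
  abs_le : ∀ u, |σ u| ≤ K
  abs_deriv_le : ∀ u, |deriv σ u| ≤ K
  abs_deriv_sub_le : ∀ u v, |deriv σ u - deriv σ v| ≤ K * |u - v|

namespace IsBoundedC11

variable {σ : ℝ → ℝ} {K : ℝ} (hσ : IsBoundedC11 σ K)
include hσ

theorem nonneg : 0 ≤ K := (abs_nonneg _).trans (hσ.abs_le 0)

theorem continuous : Continuous σ := hσ.differentiable.continuous

theorem continuous_deriv : Continuous (deriv σ) :=
  (LipschitzWith.of_dist_le_mul (K := ⟨K, hσ.nonneg⟩) hσ.abs_deriv_sub_le).continuous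

theorem abs_sub_le (u v : ℝ) : |σ u - σ v| ≤ K * |u - v| :=
  Convex.norm_image_sub_le_of_norm_deriv_le (fun x _ => hσ.differentiable x)
    (fun x _ => hσ.abs_deriv_le x) convex_univ (mem_univ v) (mem_univ u)

variable {E : Type*} [NormedAddCommGroup E] [InnerProductSpace ℝ E]

theorem abs_comp_inner_le (w x : E) : |σ (inner ℝ w x)| ≤ K * (1 + ‖x‖) ^ 2 :=
  (hσ.abs_le _).trans <| le_mul_of_one_le_right hσ.nonneg <|
    one_le_pow₀ (le_add_of_nonneg_right (norm_nonneg x))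

theorem norm_deriv_comp_inner_smul_le (w x : E) :
    ‖deriv σ (inner ℝ w x) • x‖ ≤ K * (1 + ‖x‖) ^ 2 := by
  rw [norm_smul]
  exact mul_le_mul (hσ.abs_deriv_le _) (by nlinarith [norm_nonneg x]) (norm_nonneg _) hσ.nonneg

theorem norm_deriv_comp_inner_smul_starProjection_le (S : Submodule ℝ E)
    [S.HasOrthogonalProjection] (u : ℝ) (x : E) :
    ‖deriv σ u • S.starProjection x‖ ≤ K * (1 + ‖x‖) ^ 2 := by
  rw [norm_smul]
  exact mul_le_mul (hσ.abs_deriv_le _) ((S.norm_starProjection_apply_le x).trans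
    (by nlinarith [norm_nonneg x])) (norm_nonneg _) hσ.nonneg

theorem norm_deriv_sub_deriv_smul_starProjection_le (S : Submodule ℝ E)
    [S.HasOrthogonalProjection] (w x : E) :
    ‖(deriv σ (inner ℝ w x) - deriv σ (inner ℝ w (x - S.starProjection x))) • S.starProjection x‖ ≤
      K * ‖S.starProjection w‖ * (1 + ‖x‖) ^ 2 := by
  have hK := hσ.nonneg
  have hinner : |inner ℝ w x - inner ℝ w (x - S.starProjection x)| ≤
      ‖S.starProjection w‖ * ‖x‖ := by
    rw [← inner_sub_right, sub_sub_cancel, ← S.inner_starProjection_left_eq_right]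
    exact abs_real_inner_le_norm _ _
  calc _ ≤ K * (‖S.starProjection w‖ * ‖x‖) * ‖x‖ := by
        rw [norm_smul]
        exact mul_le_mul ((hσ.abs_deriv_sub_le _ _).trans
          (mul_le_mul_of_nonneg_left hinner hK)) (S.norm_starProjection_apply_le x)
          (norm_nonneg _) (by positivity)
    _ = K * ‖S.starProjection w‖ * ‖x‖ ^ 2 := by ring
    _ ≤ K * ‖S.starProjection w‖ * (1 + ‖x‖) ^ 2 := by gcongr; linarith

end IsBoundedC11

section Weighted

variable {E F : Type*} [NormedAddCommGroup E] [MeasurableSpace E] [NormedAddCommGroup F]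
  [NormedSpace ℝ F] {γ : Measure E} {r : E → ℝ} {φ : E → F} {C : ℝ}

theorem integrable_smul_of_norm_le_sq [OpensMeasurableSpace E]
    (hr : Integrable (fun x => (1 + ‖x‖) ^ 2 * r x) γ)
    (hφ : AEStronglyMeasurable φ γ) (hC : ∀ x, ‖φ x‖ ≤ C * (1 + ‖x‖) ^ 2) :
    Integrable (fun x => r x • φ x) γ := by
  refine (hr.smul_bdd (f := fun x => ((1 + ‖x‖) ^ 2)⁻¹ • φ x) C
    ((Measurable.aestronglyMeasurable (by fun_prop)).smul hφ) (.of_forall fun x => ?_)).congr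
    (.of_forall fun x => ?_)
  · rw [norm_smul, norm_inv, norm_pow, Real.norm_of_nonneg (by positivity),
      inv_mul_le_iff₀ (by positivity), mul_comm]
    exact hC x
  · change ((1 + ‖x‖) ^ 2 * r x) • ((1 + ‖x‖) ^ 2)⁻¹ • φ x = r x • φ x
    rw [mul_comm, mul_smul, smul_inv_smul₀ (by positivity)]

theorem norm_integral_smul_le_of_norm_le_sq
    (hr : Integrable (fun x => (1 + ‖x‖) ^ 2 * r x) γ)
    (hC : ∀ x, ‖φ x‖ ≤ C * (1 + ‖x‖) ^ 2) :
    ‖∫ x, r x • φ x ∂γ‖ ≤ C * ∫ x, (1 + ‖x‖) ^ 2 * |r x| ∂γ := by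
  rw [← integral_const_mul]
  refine norm_integral_le_of_norm_le ((hr.norm.congr (.of_forall fun x => ?_)).const_mul C)
    (.of_forall fun x => ?_)
  · simp [abs_of_nonneg (add_nonneg zero_le_one (norm_nonneg x))]
  · calc ‖r x • φ x‖ ≤ |r x| * (C * (1 + ‖x‖) ^ 2) := by
          rw [norm_smul]; exact mul_le_mul_of_nonneg_left (hC x) (abs_nonneg _)
      _ = C * ((1 + ‖x‖) ^ 2 * |r x|) := by ring

end Weighted

section Ridge

variable {E : Type*} [NormedAddCommGroup E] [InnerProductSpace ℝ E] [MeasurableSpace E]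
  {γ : Measure E} {σ : ℝ → ℝ} {K : ℝ} {r r₀ : E → ℝ}

/-- The correlation `𝔼_{x ∼ γ}[r(x) σ(⟪w, x⟫)]` of `r` with the ridge function of direction `w`. -/
def ridgeCorr (γ : Measure E) (σ : ℝ → ℝ) (r : E → ℝ) (w : E) : ℝ :=
  ∫ x, r x * σ (inner ℝ w x) ∂γ

/-- The expectation `𝔼_{x ∼ γ}[r(x) σ'(⟪w, x⟫) x]`, the gradient of `ridgeCorr γ σ r`. -/
def ridgeCorrGrad (γ : Measure E) (σ : ℝ → ℝ) (r : E → ℝ) (w : E) : E :=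
  ∫ x, (r x * deriv σ (inner ℝ w x)) • x ∂γ

namespace IsBoundedC11

variable (hσ : IsBoundedC11 σ K)
include hσ

section

variable (hr : Integrable (fun x => (1 + ‖x‖) ^ 2 * r x) γ)
include hr

theorem abs_ridgeCorr_le (w : E) :
    |ridgeCorr γ σ r w| ≤ K * ∫ x, (1 + ‖x‖) ^ 2 * |r x| ∂γ :=
  norm_integral_smul_le_of_norm_le_sq hr (φ := fun x => σ (inner ℝ w x)) (hσ.abs_comp_inner_le w)

theorem norm_ridgeCorrGrad_le (w : E) :
    ‖ridgeCorrGrad γ σ r w‖ ≤ K * ∫ x, (1 + ‖x‖) ^ 2 * |r x| ∂γ := by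
  simp only [ridgeCorrGrad, mul_smul]
  exact norm_integral_smul_le_of_norm_le_sq hr (hσ.norm_deriv_comp_inner_smul_le w)

variable [OpensMeasurableSpace E]

theorem integrable_mul_comp_inner (w : E) :
    Integrable (fun x => r x * σ (inner ℝ w x)) γ := by
  have hc := hσ.continuous
  exact integrable_smul_of_norm_le_sq hr (Continuous.aestronglyMeasurable (by fun_prop))
    (hσ.abs_comp_inner_le w)

theorem integrable_mul_deriv_comp_inner_smul [SecondCountableTopology E] (w : E) :
    Integrable (fun x => (r x * deriv σ (inner ℝ w x)) • x) γ := by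
  have hc := hσ.continuous_deriv
  simp only [mul_smul]
  exact integrable_smul_of_norm_le_sq hr (Continuous.aestronglyMeasurable (by fun_prop))
    (hσ.norm_deriv_comp_inner_smul_le w)

theorem hasGradientAt_ridgeCorr [SecondCountableTopology E] [CompleteSpace E] (w : E) :
    HasGradientAt (ridgeCorr γ σ r) (ridgeCorrGrad γ σ r w) w := by
  have hgrad : ∀ w x : E, (r x * deriv σ (inner ℝ w x)) • innerSL ℝ x =
      innerSL ℝ ((r x * deriv σ (inner ℝ w x)) • x) := fun w x => (map_smul _ _ _).symm
  have hderiv : ∀ w x : E, HasFDerivAt (fun w => r x * σ (inner ℝ w x))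
      ((r x * deriv σ (inner ℝ w x)) • innerSL ℝ x) w := fun w x => by
    have hinner : HasFDerivAt (fun w : E => inner ℝ w x) (innerSL ℝ x) w := by
      simp only [real_inner_comm x]
      exact (innerSL ℝ x).hasFDerivAt
    rw [mul_smul]
    exact ((hσ.differentiable _).hasDerivAt.comp_hasFDerivAt w hinner).const_mul (r x)
  have hbound : ∀ w x : E, ‖(r x * deriv σ (inner ℝ w x)) • innerSL ℝ x‖ ≤
      K * ‖(1 + ‖x‖) ^ 2 * r x‖ := fun w x => by
    rw [hgrad, innerSL_apply_norm, mul_smul, norm_smul, norm_mul, norm_pow,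
      Real.norm_of_nonneg (by positivity : 0 ≤ 1 + ‖x‖)]
    exact (mul_le_mul_of_nonneg_left (hσ.norm_deriv_comp_inner_smul_le w x)
      (norm_nonneg _)).trans_eq (by ring)
  have hint := hσ.integrable_mul_deriv_comp_inner_smul hr w
  have key := hasFDerivAt_integral_of_dominated_of_fderiv_le (𝕜 := ℝ) (x₀ := w) univ_mem
    (.of_forall fun w => (hσ.integrable_mul_comp_inner hr w).aestronglyMeasurable)
    (hσ.integrable_mul_comp_inner hr w)
    (F' := fun w x => (r x * deriv σ (inner ℝ w x)) • innerSL ℝ x)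
    (by simpa only [hgrad] using
      (innerSL ℝ).continuous.comp_aestronglyMeasurable hint.aestronglyMeasurable)
    (.of_forall fun x w _ => hbound w x) (hr.norm.const_mul K)
    (.of_forall fun x w _ => hderiv w x)
  rw [hasGradientAt_iff_hasFDerivAt]
  refine key.congr_fderiv ?_
  simp only [hgrad]
  exact (innerSL ℝ).integral_comp_comm hint

end

theorem starProjection_ridgeCorrGrad_eq_add [OpensMeasurableSpace E] [SecondCountableTopology E]
    [CompleteSpace E] {S : Submodule ℝ E} [S.HasOrthogonalProjection] {w : E}
    (hr : Integrable (fun x => (1 + ‖x‖) ^ 2 * r x) γ)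
    (hr₀ : Integrable (fun x => (1 + ‖x‖) ^ 2 * r₀ x) γ)
    (h0 : ∫ x, (r₀ x * deriv σ (inner ℝ w (x - S.starProjection x))) • S.starProjection x ∂γ = 0) :
    S.starProjection (ridgeCorrGrad γ σ r w) =
      ∫ x, r x • (deriv σ (inner ℝ w x) - deriv σ (inner ℝ w (x - S.starProjection x))) •
        S.starProjection x ∂γ +
      ∫ x, (r x - r₀ x) • deriv σ (inner ℝ w (x - S.starProjection x)) •
        S.starProjection x ∂γ := by
  have hσ' := hσ.continuous_deriv
  set φ : E → E := fun x => deriv σ (inner ℝ w (x - S.starProjection x)) • S.starProjection x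
  set ψ : E → E := fun x =>
    (deriv σ (inner ℝ w x) - deriv σ (inner ℝ w (x - S.starProjection x))) • S.starProjection x
  have hφ : ∀ x, ‖φ x‖ ≤ K * (1 + ‖x‖) ^ 2 := fun x =>
    hσ.norm_deriv_comp_inner_smul_starProjection_le S _ x
  have hφm : AEStronglyMeasurable φ γ := Continuous.aestronglyMeasurable (by fun_prop)
  have hψm : AEStronglyMeasurable ψ γ := Continuous.aestronglyMeasurable (by fun_prop)
  have hpt : ∀ x, S.starProjection ((r x * deriv σ (inner ℝ w x)) • x) =
      r x • ψ x + ((r x - r₀ x) • φ x + r₀ x • φ x) := fun x => by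
    simp only [φ, ψ, map_smul]
    module
  have hdiff : Integrable (fun x => (1 + ‖x‖) ^ 2 * (r x - r₀ x)) γ := by
    simpa only [mul_sub] using! hr.sub hr₀
  have hiψ := integrable_smul_of_norm_le_sq hr hψm
    (hσ.norm_deriv_sub_deriv_smul_starProjection_le S w)
  have hiφ := integrable_smul_of_norm_le_sq hdiff hφm hφ
  have hiφ₀ := integrable_smul_of_norm_le_sq hr₀ hφm hφ
  have h0' : ∫ x, r₀ x • φ x ∂γ = 0 := by simpa only [φ, smul_smul] using h0
  calc S.starProjection (ridgeCorrGrad γ σ r w)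
      = ∫ x, (r x • ψ x + ((r x - r₀ x) • φ x + r₀ x • φ x)) ∂γ := by
        simp only [← hpt]
        exact (S.starProjection.integral_comp_comm
          (hσ.integrable_mul_deriv_comp_inner_smul hr w)).symm
    _ = ∫ x, r x • ψ x ∂γ + (∫ x, (r x - r₀ x) • φ x ∂γ + ∫ x, r₀ x • φ x ∂γ) := by
        rw [← integral_add hiφ hiφ₀]
        exact integral_add hiψ (hiφ.add hiφ₀)
    _ = _ := by rw [h0', add_zero]

theorem norm_starProjection_ridgeCorrGrad_le [OpensMeasurableSpace E] [SecondCountableTopology E]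
    [CompleteSpace E] {S : Submodule ℝ E} [S.HasOrthogonalProjection] {w : E}
    (hr : Integrable (fun x => (1 + ‖x‖) ^ 2 * r x) γ)
    (hr₀ : Integrable (fun x => (1 + ‖x‖) ^ 2 * r₀ x) γ)
    (h0 : ∫ x, (r₀ x * deriv σ (inner ℝ w (x - S.starProjection x))) • S.starProjection x ∂γ = 0) :
    ‖S.starProjection (ridgeCorrGrad γ σ r w)‖ ≤
      K * ‖S.starProjection w‖ * (∫ x, (1 + ‖x‖) ^ 2 * |r x| ∂γ) +
        K * ∫ x, (1 + ‖x‖) ^ 2 * |r x - r₀ x| ∂γ := by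
  have hdiff : Integrable (fun x => (1 + ‖x‖) ^ 2 * (r x - r₀ x)) γ := by
    simpa only [mul_sub] using! hr.sub hr₀
  rw [hσ.starProjection_ridgeCorrGrad_eq_add hr hr₀ h0]
  exact (norm_add_le _ _).trans (add_le_add
    (norm_integral_smul_le_of_norm_le_sq hr
      (hσ.norm_deriv_sub_deriv_smul_starProjection_le S w))
    (norm_integral_smul_le_of_norm_le_sq hdiff fun x =>
      hσ.norm_deriv_comp_inner_smul_starProjection_le S _ x))

end IsBoundedC11

/-- The reflection fixing `x - x_S` and negating `x_S` makes the integrand odd. -/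
theorem integral_comp_sub_starProjection_smul_starProjection_eq_zero [BorelSpace E]
    {S : Submodule ℝ E} [S.HasOrthogonalProjection]
    (hγ : MeasurePreserving Sᗮ.reflection γ γ) (g : E → ℝ) :
    ∫ x, g (x - S.starProjection x) • S.starProjection x ∂γ = 0 := by
  have hproj : ∀ x, S.starProjection (Sᗮ.reflection x) = -S.starProjection x := fun x => by
    have hidem : S.starProjection (S.starProjection x) = S.starProjection x :=
      S.starProjection_eq_self_iff.2 (S.starProjection_apply_mem x)
    rw [S.reflection_orthogonal_apply, S.reflection_apply, map_neg, map_sub, map_nsmul, hidem]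
    module
  have hperp : ∀ x, Sᗮ.reflection x - S.starProjection (Sᗮ.reflection x) =
      x - S.starProjection x := fun x => by
    rw [hproj, S.reflection_orthogonal_apply, S.reflection_apply]
    module
  have hodd := hγ.integral_comp Sᗮ.reflection.toHomeomorph.measurableEmbedding
    fun x => g (x - S.starProjection x) • S.starProjection x
  simp only [hperp] at hodd
  simp only [hproj, smul_neg, integral_neg] at hodd
  have : IsAddTorsionFree E := .of_isTorsionFree ℝ E
  exact self_eq_neg.1 hodd.symm

end Ridge

/-! ### The network and its potential -/

theorem integrable_one_add_norm_pow {E : Type*} [NormedAddCommGroup E] [InnerProductSpace ℝ E]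
    [FiniteDimensional ℝ E] [MeasurableSpace E] [BorelSpace E] (n : ℕ) :
    Integrable (fun x : E => (1 + ‖x‖) ^ n) (stdGaussian E) := by
  have h1 : MemLp (fun x : E => 1 + ‖x‖) n (stdGaussian E) :=
    (memLp_const (1 : ℝ)).add (IsGaussian.memLp_id (stdGaussian E) n (by simp)).norm
  refine h1.integrable_norm_pow'.congr (ae_of_all _ fun x => ?_)
  simp only [Real.norm_eq_abs]
  rw [abs_of_nonneg (by positivity)]

section Network

variable {d : ℕ} {σ : ℝ → ℝ} {K R : ℝ} {f : Inp d → ℝ} {μ : Measure (Param d)}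

theorem derivA_Phi (σ : ℝ → ℝ) (f : Inp d → ℝ) (μ : Measure (Param d)) (θ : Param d) :
    derivA (Phi σ f μ) θ = ridgeCorr (stdGaussian (Inp d)) σ (fun x => fNN σ μ x - f x) θ.2 :=
  (hasDerivAt_mul_const
    (ridgeCorr (stdGaussian (Inp d)) σ (fun x => fNN σ μ x - f x) θ.2)).deriv

namespace IsBoundedC11

variable (hσ : IsBoundedC11 σ K)
include hσ

theorem norm_neuron_le (θ : Param d) (x : Inp d) : ‖θ.1 * σ (inner ℝ θ.2 x)‖ ≤ K * |θ.1| := by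
  rw [norm_mul, mul_comm K]
  exact mul_le_mul_of_nonneg_left (hσ.abs_le _) (abs_nonneg _)

theorem stronglyMeasurable_neuron (x : Inp d) :
    StronglyMeasurable fun θ : Param d => θ.1 * σ (inner ℝ θ.2 x) := by
  have hc := hσ.continuous
  exact Continuous.stronglyMeasurable (by fun_prop)

theorem stronglyMeasurable_fNN [SFinite μ] : StronglyMeasurable (fNN σ μ) := by
  have hc := hσ.continuous
  refine StronglyMeasurable.integral_prod_right (f := fun x (θ : Param d) =>
    θ.1 * σ (inner ℝ θ.2 x)) (Continuous.stronglyMeasurable ?_)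
  fun_prop

section

variable (hμ : Integrable (fun θ => θ.1) μ)
include hμ

theorem integrable_neuron (x : Inp d) :
    Integrable (fun θ : Param d => θ.1 * σ (inner ℝ θ.2 x)) μ :=
  (hμ.abs.const_mul K).mono' (hσ.stronglyMeasurable_neuron x).aestronglyMeasurable
    (.of_forall fun θ => hσ.norm_neuron_le θ x)

theorem abs_fNN_le (x : Inp d) : |fNN σ μ x| ≤ K * ∫ θ, |θ.1| ∂μ := by
  rw [← integral_const_mul]
  exact norm_integral_le_of_norm_le (hμ.abs.const_mul K)
    (.of_forall fun θ => hσ.norm_neuron_le θ x)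

variable (hf : Integrable (fun x => (1 + ‖x‖) ^ 2 * f x) (stdGaussian (Inp d)))
include hf

theorem integrable_sq_mul_fNN_comp_sub [SFinite μ] {g : Inp d → Inp d} (hg : Measurable g) :
    Integrable (fun x => (1 + ‖x‖) ^ 2 * (fNN σ μ (g x) - f x)) (stdGaussian (Inp d)) := by
  refine (((integrable_one_add_norm_pow 2).mul_bdd (c := K * ∫ θ, |θ.1| ∂μ)
    (hσ.stronglyMeasurable_fNN.comp_measurable hg).aestronglyMeasurable
    (.of_forall fun x => hσ.abs_fNN_le hμ (g x))).sub hf).congr (.of_forall fun x => ?_)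
  exact (mul_sub _ _ _).symm

theorem integral_sq_mul_abs_fNN_sub_le :
    ∫ x, (1 + ‖x‖) ^ 2 * |fNN σ μ x - f x| ∂stdGaussian (Inp d) ≤
      (1 + K * ∫ θ, |θ.1| ∂μ) * ∫ x, (1 + ‖x‖) ^ 2 * (1 + |f x|) ∂stdGaussian (Inp d) := by
  have hM : 0 ≤ K * ∫ θ, |θ.1| ∂μ := (abs_nonneg _).trans (hσ.abs_fNN_le hμ 0)
  have hdom : Integrable (fun x => (1 + ‖x‖) ^ 2 * (1 + |f x|)) (stdGaussian (Inp d)) := by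
    refine ((integrable_one_add_norm_pow 2).add hf.abs).congr (.of_forall fun x => ?_)
    simp only [Pi.add_apply, abs_mul, abs_of_nonneg (sq_nonneg (1 + ‖x‖))]
    ring
  rw [← integral_const_mul]
  refine integral_mono_of_nonneg (.of_forall fun x => by positivity) (hdom.const_mul _)
    (.of_forall fun x => ?_)
  have hres : |fNN σ μ x - f x| ≤ (1 + K * ∫ θ, |θ.1| ∂μ) * (1 + |f x|) := by
    have h := (abs_sub (fNN σ μ x) (f x)).trans (add_le_add_left (hσ.abs_fNN_le hμ x) _)
    nlinarith [mul_nonneg hM (abs_nonneg (f x))]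
  exact (mul_le_mul_of_nonneg_left hres (by positivity)).trans_eq (mul_left_comm _ _ _)

theorem gradW_Phi [SFinite μ] (θ : Param d) :
    gradW (Phi σ f μ) θ = θ.1 •
      ridgeCorrGrad (stdGaussian (Inp d)) σ (fun x => fNN σ μ x - f x) θ.2 := by
  have h := (hσ.hasGradientAt_ridgeCorr (hσ.integrable_sq_mul_fNN_comp_sub hμ hf measurable_id)
    θ.2).hasFDerivAt.const_mul θ.1
  refine HasGradientAt.gradient (hasGradientAt_iff_hasFDerivAt.2 ?_)
  exact h.congr_fderiv (map_smul (InnerProductSpace.toDual ℝ (Inp d)).toLinearEquiv _ _).symm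

end

theorem norm_neuron_sub_neuron_le {θ : Param d} (hθ : |θ.1| ≤ R) (S : Submodule ℝ (Inp d))
    (x : Inp d) :
    ‖θ.1 * σ (inner ℝ θ.2 x) - θ.1 * σ (inner ℝ θ.2 (x - S.starProjection x))‖ ≤
      2 * K * R * (1 + ‖x‖) * min 1 ‖S.starProjection θ.2‖ := by
  have hK := hσ.nonneg
  have hR := (abs_nonneg _).trans hθ
  set u := inner ℝ θ.2 x
  set v := inner ℝ θ.2 (x - S.starProjection x)
  have huv : |u - v| ≤ ‖S.starProjection θ.2‖ * ‖x‖ := by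
    rw [← inner_sub_right, sub_sub_cancel, ← S.inner_starProjection_left_eq_right]
    exact abs_real_inner_le_norm _ _
  have hσuv : |σ u - σ v| ≤ 2 * K * (1 + ‖x‖) * min 1 ‖S.starProjection θ.2‖ := by
    rw [mul_min_of_nonneg _ _ (by positivity)]
    refine le_min ?_ ?_
    · have h := (abs_sub _ _).trans (add_le_add (hσ.abs_le u) (hσ.abs_le v))
      nlinarith [mul_nonneg hK (norm_nonneg x)]
    · refine (hσ.abs_sub_le u v).trans ((mul_le_mul_of_nonneg_left huv hK).trans ?_)
      nlinarith [mul_nonneg hK (norm_nonneg (S.starProjection θ.2)),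
        mul_nonneg (mul_nonneg hK (norm_nonneg (S.starProjection θ.2))) (norm_nonneg x)]
  rw [← mul_sub, norm_mul]
  exact (mul_le_mul hθ hσuv (abs_nonneg _) hR).trans_eq (by ring)

theorem integral_fNN_sub_mul_smul_starProjection_eq_zero {S : Submodule ℝ (Inp d)} {w : Inp d}
    (hr₀ : Integrable (fun x => (1 + ‖x‖) ^ 2 * (fNN σ μ (x - S.starProjection x) - f x))
      (stdGaussian (Inp d)))
    (hf : Integrable (fun x => (1 + ‖x‖) ^ 2 * f x) (stdGaussian (Inp d)))
    (hcond : ∫ x, (f x * deriv σ (inner ℝ w (x - S.starProjection x))) •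
      S.starProjection x ∂stdGaussian (Inp d) = 0) :
    ∫ x, ((fNN σ μ (x - S.starProjection x) - f x) *
      deriv σ (inner ℝ w (x - S.starProjection x))) • S.starProjection x
        ∂stdGaussian (Inp d) = 0 := by
  have hσ' := hσ.continuous_deriv
  set φ : Inp d → Inp d := fun x =>
    deriv σ (inner ℝ w (x - S.starProjection x)) • S.starProjection x
  have hφm : AEStronglyMeasurable φ (stdGaussian (Inp d)) :=
    Continuous.aestronglyMeasurable (by fun_prop)
  have hφ : ∀ x, ‖φ x‖ ≤ K * (1 + ‖x‖) ^ 2 := fun x =>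
    hσ.norm_deriv_comp_inner_smul_starProjection_le S _ x
  have hnet : ∫ x, fNN σ μ (x - S.starProjection x) • φ x ∂stdGaussian (Inp d) = 0 := by
    simpa only [φ, smul_smul] using
      integral_comp_sub_starProjection_smul_starProjection_eq_zero (S := S)
        ⟨Sᗮ.reflection.continuous.measurable, stdGaussian_map Sᗮ.reflection⟩
        fun y => fNN σ μ y * deriv σ (inner ℝ w y)
  simp only [mul_smul] at hcond ⊢
  rw [← hnet, ← add_zero (∫ x, (fNN σ μ _ - f x) • _ ∂_), ← hcond,
    ← integral_add (integrable_smul_of_norm_le_sq hr₀ hφm hφ)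
      (integrable_smul_of_norm_le_sq hf hφm hφ)]
  simp only [φ, ← add_smul, sub_add_cancel]

variable [IsProbabilityMeasure μ] (hμ : ∀ᵐ θ ∂μ, |θ.1| ≤ R) {S : Submodule ℝ (Inp d)}
include hμ

theorem abs_fNN_sub_fNN_le (x : Inp d) :
    |fNN σ μ x - fNN σ μ (x - S.starProjection x)| ≤
      2 * K * R * (1 + ‖x‖) * ∫ θ, min 1 ‖S.starProjection θ.2‖ ∂μ := by
  have hint : Integrable (fun θ => θ.1) μ :=
    .of_bound measurable_fst.aestronglyMeasurable R hμ
  have hmin : Integrable (fun θ : Param d => min 1 ‖S.starProjection θ.2‖) μ :=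
    .of_bound (Continuous.aestronglyMeasurable (by fun_prop)) 1 (.of_forall fun θ => by
      rw [Real.norm_of_nonneg (by positivity)]
      exact min_le_left _ _)
  rw [fNN, fNN, ← integral_sub (hσ.integrable_neuron hint _) (hσ.integrable_neuron hint _),
    ← integral_const_mul]
  exact norm_integral_le_of_norm_le (hmin.const_mul _)
    (hμ.mono fun θ hθ => hσ.norm_neuron_sub_neuron_le hθ S x)

theorem integral_sq_mul_abs_fNN_sub_fNN_le :
    ∫ x, (1 + ‖x‖) ^ 2 * |fNN σ μ x - fNN σ μ (x - S.starProjection x)| ∂stdGaussian (Inp d) ≤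
      2 * K * R * (∫ x, (1 + ‖x‖) ^ 3 ∂stdGaussian (Inp d)) *
        ∫ θ, min 1 ‖S.starProjection θ.2‖ ∂μ := by
  rw [mul_right_comm, ← integral_const_mul]
  refine integral_mono_of_nonneg (.of_forall fun x => by positivity)
    ((integrable_one_add_norm_pow 3).const_mul _) (.of_forall fun x => ?_)
  exact (mul_le_mul_of_nonneg_left (hσ.abs_fNN_sub_fNN_le hμ x) (by positivity)).trans_eq (by ring)

theorem norm_starProjection_ridgeCorrGrad_fNN_sub_le
    (hf : Integrable (fun x => (1 + ‖x‖) ^ 2 * f x) (stdGaussian (Inp d)))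
    (hcond : ∀ w, ∫ x, (f x * deriv σ (inner ℝ w (x - S.starProjection x))) •
      S.starProjection x ∂stdGaussian (Inp d) = 0) (w : Inp d) :
    ‖S.starProjection (ridgeCorrGrad (stdGaussian (Inp d)) σ (fun x => fNN σ μ x - f x) w)‖ ≤
      K * ‖S.starProjection w‖ *
          ((1 + K * R) * ∫ x, (1 + ‖x‖) ^ 2 * (1 + |f x|) ∂stdGaussian (Inp d)) +
        K * (2 * K * R * (∫ x, (1 + ‖x‖) ^ 3 ∂stdGaussian (Inp d)) *
          ∫ θ, min 1 ‖S.starProjection θ.2‖ ∂μ) := by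
  have hK := hσ.nonneg
  have hint : Integrable (fun θ => θ.1) μ := .of_bound measurable_fst.aestronglyMeasurable R hμ
  have hmean : ∫ θ, |θ.1| ∂μ ≤ R := by
    simpa using integral_mono_ae hint.abs (integrable_const R) hμ
  have hA : 0 ≤ ∫ x, (1 + ‖x‖) ^ 2 * (1 + |f x|) ∂stdGaussian (Inp d) :=
    integral_nonneg fun x => by positivity
  set r : Inp d → ℝ := fun x => fNN σ μ x - f x
  set r₀ : Inp d → ℝ := fun x => fNN σ μ (x - S.starProjection x) - f x
  have hr : Integrable (fun x => (1 + ‖x‖) ^ 2 * r x) (stdGaussian (Inp d)) :=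
    hσ.integrable_sq_mul_fNN_comp_sub hint hf measurable_id
  have hr₀ : Integrable (fun x => (1 + ‖x‖) ^ 2 * r₀ x) (stdGaussian (Inp d)) :=
    hσ.integrable_sq_mul_fNN_comp_sub hint hf (by fun_prop)
  have hr_le := (hσ.integral_sq_mul_abs_fNN_sub_le hint hf).trans
    (mul_le_mul_of_nonneg_right (by gcongr : 1 + K * ∫ θ, |θ.1| ∂μ ≤ 1 + K * R) hA)
  have hdiff_le : ∫ x, (1 + ‖x‖) ^ 2 * |r x - r₀ x| ∂stdGaussian (Inp d) ≤
      2 * K * R * (∫ x, (1 + ‖x‖) ^ 3 ∂stdGaussian (Inp d)) *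
        ∫ θ, min 1 ‖S.starProjection θ.2‖ ∂μ := by
    simpa only [r, r₀, sub_sub_sub_cancel_right] using hσ.integral_sq_mul_abs_fNN_sub_fNN_le hμ
  have h0 : ∫ x, (r₀ x * deriv σ (inner ℝ w (x - S.starProjection x))) • S.starProjection x
      ∂stdGaussian (Inp d) = 0 :=
    hσ.integral_fNN_sub_mul_smul_starProjection_eq_zero hr₀ hf (hcond w)
  refine (hσ.norm_starProjection_ridgeCorrGrad_le hr hr₀ h0).trans ?_
  gcongr

end IsBoundedC11

end Network

/-! ### Mean-field solutions and the continuity equation -/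

theorem derivA_mul_add_inner_gradW {d : ℕ} {h : Param d → ℝ} {θ : Param d}
    (hh : DifferentiableAt ℝ h θ) (x : ℝ) (v : Inp d) :
    derivA h θ * x + inner ℝ (gradW h θ) v = fderiv ℝ h θ (x, v) := by
  have h1 : HasDerivAt (fun a : ℝ => h (a, θ.2)) (fderiv ℝ h θ (1, 0)) θ.1 := by
    have := (show HasFDerivAt h (fderiv ℝ h θ) (θ.1, θ.2) from hh.hasFDerivAt).comp θ.1
      (hasFDerivAt_prodMk_left (𝕜 := ℝ) θ.1 θ.2)
    simpa [Function.comp_def] using this.hasDerivAt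
  have h2 : HasFDerivAt (fun w : Inp d => h (θ.1, w))
      ((fderiv ℝ h θ).comp (ContinuousLinearMap.inr ℝ ℝ (Inp d))) θ.2 :=
    (show HasFDerivAt h (fderiv ℝ h θ) (θ.1, θ.2) from hh.hasFDerivAt).comp θ.2
      (hasFDerivAt_prodMk_right (𝕜 := ℝ) θ.1 θ.2)
  have e1 : derivA h θ = fderiv ℝ h θ (1, 0) := h1.deriv
  have e2 : inner ℝ (gradW h θ) v = fderiv ℝ h θ (0, v) := by
    rw [gradW, gradient, h2.fderiv, InnerProductSpace.toDual_symm_apply]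
    simp
  rw [e1, e2, mul_comm, ← smul_eq_mul, ← map_smul, ← map_add]
  simp

section Velocity

variable {d : ℕ} {σ : ℝ → ℝ} {f : Inp d → ℝ} {α β Kσ Kξ : ℝ} {μ : Measure (Param d)}

/-- The velocity `-ξ ∇_θ Φ(θ; μ)` of the flow for `ξ = diag(α, β I_d)`. It is written with
correlations instead of `derivA` and `gradW`, so that it is jointly measurable along a curve of
measures also at the exceptional times at which the neurons are not integrable. -/
def meanFieldVelocity (σ : ℝ → ℝ) (f : Inp d → ℝ) (α β : ℝ) (μ : Measure (Param d))
    (θ : Param d) : Param d :=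
  (-(α * ridgeCorr (stdGaussian (Inp d)) σ (fun x => fNN σ μ x - f x) θ.2),
    -(β • θ.1 • ridgeCorrGrad (stdGaussian (Inp d)) σ (fun x => fNN σ μ x - f x) θ.2))

/-- A bound for the velocity of the `a`-coordinate. -/
def velocityBound (f : Inp d → ℝ) (Kσ Kξ : ℝ) (μ : Measure (Param d)) : ℝ :=
  Kξ * (Kσ * ((1 + Kσ * ∫ θ, |θ.1| ∂μ) *
    ∫ x, (1 + ‖x‖) ^ 2 * (1 + |f x|) ∂stdGaussian (Inp d)))

theorem velocityBound_nonneg (hKσ : 0 ≤ Kσ) (hKξ : 0 ≤ Kξ) : 0 ≤ velocityBound f Kσ Kξ μ := by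
  have hM : 0 ≤ ∫ θ, |θ.1| ∂μ := integral_nonneg fun θ => abs_nonneg _
  have hA : 0 ≤ ∫ x, (1 + ‖x‖) ^ 2 * (1 + |f x|) ∂stdGaussian (Inp d) :=
    integral_nonneg fun x => by positivity
  exact mul_nonneg hKξ (mul_nonneg hKσ
    (mul_nonneg (add_nonneg zero_le_one (mul_nonneg hKσ hM)) hA))

namespace IsBoundedC11

variable (hσ : IsBoundedC11 σ Kσ)
  (hf : Integrable (fun x => (1 + ‖x‖) ^ 2 * f x) (stdGaussian (Inp d)))
include hσ hf

section

variable [SFinite μ] (hμ : Integrable (fun θ => θ.1) μ)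
include hμ

theorem abs_fst_meanFieldVelocity_le (hα : |α| ≤ Kξ) (θ : Param d) :
    |(meanFieldVelocity σ f α β μ θ).1| ≤ velocityBound f Kσ Kξ μ := by
  have hr := hσ.integrable_sq_mul_fNN_comp_sub hμ hf measurable_id
  rw [meanFieldVelocity, abs_neg, abs_mul]
  exact mul_le_mul hα ((hσ.abs_ridgeCorr_le hr θ.2).trans
    (mul_le_mul_of_nonneg_left (hσ.integral_sq_mul_abs_fNN_sub_le hμ hf) hσ.nonneg))
    (abs_nonneg _) ((abs_nonneg _).trans hα)

theorem norm_snd_meanFieldVelocity_le (hβ : |β| ≤ Kξ) (θ : Param d) :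
    ‖(meanFieldVelocity σ f α β μ θ).2‖ ≤ |θ.1| * velocityBound f Kσ Kξ μ := by
  have hr := hσ.integrable_sq_mul_fNN_comp_sub hμ hf measurable_id
  rw [meanFieldVelocity, norm_neg, smul_comm, norm_smul, norm_smul]
  exact mul_le_mul_of_nonneg_left (mul_le_mul hβ ((hσ.norm_ridgeCorrGrad_le hr θ.2).trans
    (mul_le_mul_of_nonneg_left (hσ.integral_sq_mul_abs_fNN_sub_le hμ hf) hσ.nonneg))
    (norm_nonneg _) ((abs_nonneg _).trans hβ)) (abs_nonneg _)

theorem norm_meanFieldVelocity_le (hα : |α| ≤ Kξ) (hβ : |β| ≤ Kξ) (θ : Param d) :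
    ‖meanFieldVelocity σ f α β μ θ‖ ≤ (1 + |θ.1|) * velocityBound f Kσ Kξ μ := by
  have hB : 0 ≤ velocityBound f Kσ Kξ μ :=
    velocityBound_nonneg hσ.nonneg ((abs_nonneg _).trans hα)
  refine norm_prod_le_iff.2 ⟨(hσ.abs_fst_meanFieldVelocity_le hf hμ hα θ).trans ?_,
    (hσ.norm_snd_meanFieldVelocity_le hf hμ hβ θ).trans ?_⟩ <;>
  nlinarith [abs_nonneg θ.1]

theorem derivA_mul_add_inner_gradW_Phi {h : Param d → ℝ} {θ : Param d}
    (hh : DifferentiableAt ℝ h θ) :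
    α * (derivA h θ * derivA (Phi σ f μ) θ) + β * inner ℝ (gradW h θ) (gradW (Phi σ f μ) θ) =
      -fderiv ℝ h θ (meanFieldVelocity σ f α β μ θ) := by
  rw [derivA_Phi, hσ.gradW_Phi hμ hf, ← map_neg, meanFieldVelocity, Prod.neg_mk, neg_neg, neg_neg,
    ← derivA_mul_add_inner_gradW hh, inner_smul_right, inner_smul_right, inner_smul_right]
  ring

end

theorem exists_norm_starProjection_snd_meanFieldVelocity_le {S : Submodule ℝ (Inp d)}
    (hcond : ∀ w, ∫ x, (f x * deriv σ (inner ℝ w (x - S.starProjection x))) •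
      S.starProjection x ∂stdGaussian (Inp d) = 0) {R : ℝ} (hR : 0 ≤ R) (hKξ : 0 ≤ Kξ) :
    ∃ C, 0 ≤ C ∧ ∀ (μ : Measure (Param d)) [IsProbabilityMeasure μ], (∀ᵐ θ ∂μ, |θ.1| ≤ R) →
      ∀ α β, |β| ≤ Kξ → ∀ θ : Param d, |θ.1| ≤ R →
        ‖S.starProjection (meanFieldVelocity σ f α β μ θ).2‖ ≤
          C * (‖S.starProjection θ.2‖ + ∫ θ', min 1 ‖S.starProjection θ'.2‖ ∂μ) := by
  have hK := hσ.nonneg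
  set A := ∫ x, (1 + ‖x‖) ^ 2 * (1 + |f x|) ∂stdGaussian (Inp d)
  set B := ∫ x, (1 + ‖x‖) ^ 3 ∂stdGaussian (Inp d)
  have hA : 0 ≤ A := integral_nonneg fun x => by positivity
  have hB : 0 ≤ B := integral_nonneg fun x => by positivity
  refine ⟨R * (Kξ * (Kσ * ((1 + Kσ * R) * A) + Kσ * (2 * Kσ * R * B))), by positivity,
    fun μ _ hμ α β hβ θ hθ => ?_⟩
  have hm : 0 ≤ ∫ θ', min 1 ‖S.starProjection θ'.2‖ ∂μ := integral_nonneg fun θ => by positivity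
  set m := ∫ θ', min 1 ‖S.starProjection θ'.2‖ ∂μ
  set q := ‖S.starProjection θ.2‖
  have hq : 0 ≤ q := norm_nonneg _
  have hgrad : _ ≤ Kσ * q * ((1 + Kσ * R) * A) + Kσ * (2 * Kσ * R * B * m) :=
    hσ.norm_starProjection_ridgeCorrGrad_fNN_sub_le hμ hf hcond θ.2
  rw [meanFieldVelocity, map_neg, map_smul, map_smul, norm_neg, smul_comm, norm_smul, norm_smul,
    mul_assoc R, mul_assoc Kξ]
  refine mul_le_mul hθ (mul_le_mul hβ (hgrad.trans ?_) (norm_nonneg _) hKξ) (by positivity) hR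
  clear_value A B m q
  have hcross : 0 ≤ Kσ * ((1 + Kσ * R) * A) * m + Kσ * (2 * Kσ * R * B) * q := by positivity
  linear_combination hcross

end IsBoundedC11

end Velocity

section MeanFieldSolution

variable {d : ℕ}

theorem measurable_meanFieldVelocity {σ : ℝ → ℝ} {Kσ : ℝ} (hσ : IsBoundedC11 σ Kσ)
    {f : Inp d → ℝ} (hf : Measurable f) {ξa ξw : ℝ → ℝ} (hξa : Measurable ξa)
    (hξw : Measurable ξw) {ρ : ℝ → ProbabilityMeasure (Param d)} (hρ : Continuous ρ) :
    Measurable (Function.uncurry fun t => meanFieldVelocity σ f (ξa t) (ξw t) (ρ t)) := by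
  have hσc := hσ.continuous
  have hσ' := hσ.continuous_deriv
  have hnet : StronglyMeasurable fun q : ℝ × Inp d => fNN σ (ρ q.1) q.2 :=
    stronglyMeasurable_integral_of_continuous (hρ.comp continuous_fst)
      (g := fun (q : ℝ × Inp d) (θ : Param d) => θ.1 * σ (inner ℝ θ.2 q.2))
      (Continuous.stronglyMeasurable (by fun_prop))
  have hres : StronglyMeasurable fun z : (ℝ × Inp d) × Inp d => fNN σ (ρ z.1.1) z.2 - f z.2 :=
    (hnet.comp_measurable (measurable_fst.fst.prodMk measurable_snd)).sub
      (hf.comp measurable_snd).stronglyMeasurable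
  have hcorr : Measurable fun q : ℝ × Inp d =>
      ridgeCorr (stdGaussian (Inp d)) σ (fun x => fNN σ (ρ q.1) x - f x) q.2 :=
    (StronglyMeasurable.integral_prod_right (hres.mul
      (g := fun z : (ℝ × Inp d) × Inp d => σ (inner ℝ z.1.2 z.2))
      (Continuous.stronglyMeasurable (by fun_prop)))).measurable
  have hgrad : Measurable fun q : ℝ × Inp d =>
      ridgeCorrGrad (stdGaussian (Inp d)) σ (fun x => fNN σ (ρ q.1) x - f x) q.2 :=
    (StronglyMeasurable.integral_prod_right ((hres.mul
      (g := fun z : (ℝ × Inp d) × Inp d => deriv σ (inner ℝ z.1.2 z.2))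
      (Continuous.stronglyMeasurable (by fun_prop))).smul
      (g := fun z : (ℝ × Inp d) × Inp d => z.2)
      (Continuous.stronglyMeasurable (by fun_prop)))).measurable
  have htw : Measurable fun z : ℝ × Param d => (z.1, z.2.2) :=
    measurable_fst.prodMk measurable_snd.snd
  exact ((hξa.comp measurable_fst).mul (hcorr.comp htw)).neg.prodMk
    ((hξw.comp measurable_fst).smul (measurable_snd.fst.smul (hgrad.comp htw))).neg

theorem isTestFunction_mul {h : Param d → ℝ} {p : ℝ → ℝ} (hh : ContDiff ℝ ∞ h)
    (hhc : HasCompactSupport h) (hp : ContDiff ℝ ∞ p) (hpc : HasCompactSupport p)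
    (hp0 : tsupport p ⊆ Ioi 0) : IsTestFunction fun q : Param d × ℝ => h q.1 * p q.2 where
  smooth := (hh.comp contDiff_fst).mul (hp.comp contDiff_snd)
  compact := .of_support_subset_isCompact (IsCompact.prod hhc hpc) fun _ hq =>
    ⟨subset_tsupport _ (left_ne_zero_of_mul hq), subset_tsupport _ (right_ne_zero_of_mul hq)⟩
  support := Subset.trans (closure_minimal
    (fun _ hq => subset_tsupport p (right_ne_zero_of_mul hq))
    ((isClosed_tsupport p).preimage continuous_snd)) fun _ hq => hp0 hq

theorem measurable_lintegral_enorm_fst {ρ : ℝ → ProbabilityMeasure (Param d)}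
    (hρ : Continuous ρ) : Measurable fun t => ∫⁻ θ, ‖θ.1‖ₑ ∂(ρ t : Measure (Param d)) :=
  (Measure.measurable_lintegral measurable_fst.enorm).comp (measurable_toMeasure_of_continuous hρ)

namespace IsMeanFieldSolution

variable {σ : ℝ → ℝ} {f : Inp d → ℝ} {ξa ξw : ℝ → ℝ} {ρ₀ : Measure (Param d)}
  {ρ : ℝ → ProbabilityMeasure (Param d)} (hρ : IsMeanFieldSolution σ f ξa ξw ρ₀ ρ)
include hρ

theorem continuous_comp_max : Continuous fun t => ρ (max t 0) :=
  hρ.continuousOn.comp_continuous (by fun_prop) fun t => le_max_right t 0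

theorem comp_max : IsMeanFieldSolution σ f (fun t => ξa (max t 0)) (fun t => ξw (max t 0)) ρ₀
    fun t => ρ (max t 0) where
  initial := by rw [max_self, hρ.initial]
  continuousOn := hρ.continuous_comp_max.continuousOn
  integrable T := by
    refine (setLIntegral_congr_fun measurableSet_Ioc fun t ht => ?_).trans_lt (hρ.integrable T)
    simp only [max_eq_left ht.1.le]
  weak η hη := by
    refine Eq.trans (setIntegral_congr_fun measurableSet_Ioi fun t (ht : 0 < t) => ?_)
      (hρ.weak η hη)
    simp only [max_eq_left ht.le]

variable (hc : Continuous ρ)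
include hc

theorem integrableOn_integral_abs_fst (T : ℝ) :
    IntegrableOn (fun t => ∫ θ, |θ.1| ∂(ρ t : Measure (Param d))) (Ioc 0 T) := by
  refine (integrable_toReal_of_lintegral_ne_top
    (measurable_lintegral_enorm_fst hc).aemeasurable (hρ.integrable T).ne).congr
    (.of_forall fun t => ?_)
  exact (integral_norm_eq_lintegral_enorm measurable_fst.aestronglyMeasurable).symm

theorem ae_integrable_fst : ∀ᵐ t ∂volume.restrict (Ioi (0 : ℝ)),
    Integrable (fun θ => θ.1) (ρ t : Measure (Param d)) := by
  have hcover : Ioi (0 : ℝ) = ⋃ n : ℕ, Ioc (0 : ℝ) n := by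
    ext t
    simp only [mem_Ioi, mem_iUnion, mem_Ioc, exists_and_left, iff_self_and]
    exact fun _ => exists_nat_ge t
  rw [hcover, ae_restrict_iUnion_iff]
  intro n
  filter_upwards [ae_lt_top (measurable_lintegral_enorm_fst hc) (hρ.integrable n).ne] with t ht
  exact ⟨measurable_fst.aestronglyMeasurable, ht⟩

theorem solvesContinuityEquation {Kσ : ℝ} (hσ : IsBoundedC11 σ Kσ) (hfm : Measurable f)
    (hf : Integrable (fun x => (1 + ‖x‖) ^ 2 * f x) (stdGaussian (Inp d)))
    (hξa : Measurable ξa) (hξw : Measurable ξw) :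
    SolvesContinuityEquation ρ fun t => meanFieldVelocity σ f (ξa t) (ξw t) (ρ t) where
  continuous := hc
  measurable_velocity := measurable_meanFieldVelocity hσ hfm hξa hξw hc
  weak h hh hhc p hp hpc hp0 := by
    rw [← neg_eq_zero, ← integral_neg]
    refine Eq.trans ?_ (hρ.weak _ (isTestFunction_mul hh hhc hp hpc hp0))
    refine integral_congr_ae ((hρ.ae_integrable_fst hc).mono fun t ht => ?_)
    simp only [← integral_neg]
    refine integral_congr_ae (.of_forall fun θ => ?_)
    have hd : DifferentiableAt ℝ h θ := hh.differentiable (by simp) θ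
    simp only [hσ.derivA_mul_add_inner_gradW_Phi hf ht (hd.mul_const (p t)),
      fderiv_mul_const hd, deriv_const_mul_field, _root_.smul_apply, smul_eq_mul]
    ring

end IsMeanFieldSolution

namespace IsMeanFieldSolution

variable {σ : ℝ → ℝ} {f : Inp d → ℝ} {ξa ξw : ℝ → ℝ} {ρ₀ : Measure (Param d)}
  {ρ : ℝ → ProbabilityMeasure (Param d)} {Kσ Kξ Kρ : ℝ}

theorem ae_starProjection_snd_eq_zero_of_continuous (hρ : IsMeanFieldSolution σ f ξa ξw ρ₀ ρ)
    (hc : Continuous ρ) (hσ : IsBoundedC11 σ Kσ) (hfm : Measurable f)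
    (hf : Integrable (fun x => (1 + ‖x‖) ^ 2 * f x) (stdGaussian (Inp d)))
    (hξa : Measurable ξa) (hξw : Measurable ξw) (hξa_le : ∀ t, |ξa t| ≤ Kξ)
    (hξw_le : ∀ t, |ξw t| ≤ Kξ) {S : Submodule ℝ (Inp d)} (ha : ∀ᵐ θ ∂ρ₀, |θ.1| ≤ Kρ)
    (hw : ∀ᵐ θ ∂ρ₀, S.starProjection θ.2 = 0)
    (hcond : ∀ w, ∫ x, (f x * deriv σ (inner ℝ w (x - S.starProjection x))) •
      S.starProjection x ∂stdGaussian (Inp d) = 0) {T : ℝ} (hT : 0 ≤ T) :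
    ∀ᵐ θ ∂(ρ T : Measure (Param d)), S.starProjection θ.2 = 0 := by
  rw [← hρ.initial] at ha hw
  have hKξ : 0 ≤ Kξ := (abs_nonneg _).trans (hξa_le 0)
  have hv := hρ.solvesContinuityEquation hc hσ hfm hf hξa hξw
  set B : ℝ → ℝ := fun t => velocityBound f Kσ Kξ (ρ t)
  have hB : ∀ T, IntegrableOn B (Ioc 0 T) := fun T =>
    ((((integrable_const (1 : ℝ)).add ((hρ.integrableOn_integral_abs_fst hc T).const_mul
      Kσ)).mul_const _).const_mul Kσ).const_mul Kξ
  have hspeed : ∀ R, ∃ B' : ℝ → ℝ, (∀ T, IntegrableOn B' (Ioc 0 T)) ∧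
      ∀ᵐ t ∂volume.restrict (Ioi 0), ∀ θ : Param d, |θ.1| ≤ R →
        ‖meanFieldVelocity σ f (ξa t) (ξw t) (ρ t) θ‖ ≤ B' t := fun R => by
    refine ⟨fun t => (1 + R) * B t, fun T => (hB T).const_mul _, ?_⟩
    filter_upwards [hρ.ae_integrable_fst hc] with t ht θ hθ
    exact (hσ.norm_meanFieldVelocity_le hf ht (hξa_le t) (hξw_le t) θ).trans
      (mul_le_mul_of_nonneg_right (by linarith) (velocityBound_nonneg hσ.nonneg hKξ))
  obtain ⟨R, hR⟩ := hv.exists_forall_ae_abs_le (ℓ := ContinuousLinearMap.fst ℝ ℝ (Inp d))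
    (fun t => velocityBound_nonneg hσ.nonneg hKξ) hB ((hρ.ae_integrable_fst hc).mono fun t ht θ =>
      hσ.abs_fst_meanFieldVelocity_le (β := ξw t) hf ht (hξa_le t) θ) hspeed ha T
  have hR0 : 0 ≤ R := (hR 0 ⟨le_rfl, hT⟩).exists.elim fun θ hθ => (abs_nonneg _).trans hθ
  obtain ⟨C, hC, hCv⟩ := hσ.exists_norm_starProjection_snd_meanFieldVelocity_le hf hcond hR0 hKξ
  refine hv.ae_apply_eq_zero (P := S.starProjection.comp (ContinuousLinearMap.snd ℝ ℝ (Inp d)))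
    hT hC hR hspeed ?_ hw
  filter_upwards [ae_restrict_mem measurableSet_Ioc] with t ht
  exact hCv (ρ t) (hR t (Ioc_subset_Icc_self ht)) (ξa t) (ξw t) (hξw_le t)

end IsMeanFieldSolution

theorem projS_eq_zero_iff (S : Submodule ℝ (Inp d)) (θ : Param d) :
    projS S θ = 0 ↔ S.starProjection θ.2 = 0 := by
  rw [projS, Submodule.starProjection_apply, ZeroMemClass.coe_eq_zero]

theorem map_projS_eq_dirac_iff (S : Submodule ℝ (Inp d)) (μ : Measure (Param d))
    [IsProbabilityMeasure μ] :
    μ.map (projS S) = Measure.dirac 0 ↔ ∀ᵐ θ ∂μ, S.starProjection θ.2 = 0 := by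
  have hproj : Measurable (projS S) :=
    (S.orthogonalProjectionOnto.continuous.comp continuous_snd).measurable
  simp only [← projS_eq_zero_iff]
  refine ⟨fun h => ae_of_ae_map (p := fun z => z = 0) hproj.aemeasurable ?_, fun h => ?_⟩
  · rw [h]
    exact (ae_dirac_iff (measurableSet_singleton 0)).2 rfl
  · rw [Measure.map_congr (g := fun _ => 0) h, Measure.map_const, measure_univ, one_smul]

end MeanFieldSolution

section Assumptions

variable {d : ℕ}

theorem ActivationAssumption.isBoundedC11 {σ : ℝ → ℝ} {K : ℝ} (hσ : ActivationAssumption σ K) :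
    IsBoundedC11 σ K where
  differentiable := hσ.contDiff.differentiable two_ne_zero
  abs_le := hσ.bound
  abs_deriv_le := hσ.bound_deriv
  abs_deriv_sub_le u v := by
    have hC2 : ContDiff ℝ (1 + 1) σ := by simpa only [one_add_one_eq_two] using hσ.contDiff
    have hdiff : Differentiable ℝ (deriv σ) :=
      (contDiff_succ_iff_deriv.1 hC2).2.2.differentiable one_ne_zero
    exact Convex.norm_image_sub_le_of_norm_deriv_le (fun x _ => hdiff x)
      (fun x _ => hσ.bound_deriv2 x) convex_univ (mem_univ v) (mem_univ u)

theorem LearningRateAssumption.measurable_domRestrict {ξ : ℝ → ℝ} {K : ℝ}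
    (hξ : LearningRateAssumption ξ K) : Measurable ((Ici 0).domRestrict ξ) :=
  hξ.lipschitz.elim fun _ h => h.to_restrict.continuous.measurable

theorem LearningRateAssumption.abs_le {ξ : ℝ → ℝ} {K : ℝ} (hξ : LearningRateAssumption ξ K)
    (t : ℝ) (ht : 0 ≤ t) : |ξ t| ≤ K := by
  rw [abs_of_nonneg (hξ.nonneg t ht)]
  exact hξ.bound t ht

theorem InitialAssumption.ae_abs_fst_le {ρ₀ : Measure (Param d)} {K : ℝ}
    (hρ₀ : InitialAssumption ρ₀ K) : ∀ᵐ θ ∂ρ₀, |θ.1| ≤ K := by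
  obtain ⟨ρa, ρw, _, _, rfl, -, hsupp⟩ := hρ₀
  have hfst : ∀ᵐ a ∂ρa, |a| ≤ K :=
    measure_mono_null (fun a ha (h : a ∈ Icc (-K) K) => ha (abs_le.2 h)) hsupp
  exact Measure.quasiMeasurePreserving_fst.ae hfst

theorem exists_abs_mvPolynomial_eval_le {ι : Type*} [Fintype ι] (p : MvPolynomial ι ℝ) :
    ∃ (C : ℝ) (N : ℕ), 0 ≤ C ∧ ∀ x : EuclideanSpace ℝ ι,
      |MvPolynomial.eval (fun i => x i) p| ≤ C * (1 + ‖x‖) ^ N := by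
  induction p using MvPolynomial.induction_on with
  | C a => exact ⟨|a|, 0, abs_nonneg a, fun x => by simp⟩
  | add p q hp hq =>
    obtain ⟨C, N, hC, hp⟩ := hp
    obtain ⟨C', N', hC', hq⟩ := hq
    refine ⟨C + C', max N N', by positivity, fun x => ?_⟩
    have hx : (1 : ℝ) ≤ 1 + ‖x‖ := le_add_of_nonneg_right (norm_nonneg x)
    rw [map_add, add_mul]
    refine (abs_add_le _ _).trans (add_le_add ((hp x).trans ?_) ((hq x).trans ?_))
    · exact mul_le_mul_of_nonneg_left (pow_le_pow_right₀ hx (le_max_left _ _)) hC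
    · exact mul_le_mul_of_nonneg_left (pow_le_pow_right₀ hx (le_max_right _ _)) hC'
  | mul_X p i hp =>
    obtain ⟨C, N, hC, hp⟩ := hp
    refine ⟨C, N + 1, hC, fun x => ?_⟩
    have hx : |x i| ≤ 1 + ‖x‖ := (PiLp.norm_apply_le x i).trans (le_add_of_nonneg_left zero_le_one)
    rw [map_mul, MvPolynomial.eval_X, abs_mul, pow_succ, ← mul_assoc]
    exact mul_le_mul (hp x) hx (abs_nonneg _) (by positivity)

theorem IsSubspaceSparsePolynomial.continuous {V : Submodule ℝ (Inp d)} {f : Inp d → ℝ}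
    (hf : IsSubspaceSparsePolynomial V f) : Continuous f := by
  obtain ⟨h, ⟨p, hp⟩, hfh⟩ := hf
  rw [funext fun x => (hfh x).trans (hp _)]
  exact (MvPolynomial.continuous_eval p).comp (continuous_pi fun i => by fun_prop)

theorem IsSubspaceSparsePolynomial.integrable_sq_mul {V : Submodule ℝ (Inp d)} {f : Inp d → ℝ}
    (hf : IsSubspaceSparsePolynomial V f) :
    Integrable (fun x => (1 + ‖x‖) ^ 2 * f x) (stdGaussian (Inp d)) := by
  have hfc := hf.continuous
  obtain ⟨h, ⟨p, hp⟩, hfh⟩ := hf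
  obtain ⟨C, N, hC, hpC⟩ := exists_abs_mvPolynomial_eval_le p
  have hfC : ∀ x, |f x| ≤ C * (1 + ‖x‖) ^ N := fun x => by
    rw [hfh, hp]
    refine (hpC _).trans ?_
    gcongr
    exact V.norm_orthogonalProjectionOnto_apply_le x
  refine ((integrable_one_add_norm_pow (2 + N)).const_mul C).mono'
    (Continuous.aestronglyMeasurable (by fun_prop)) (.of_forall fun x => ?_)
  rw [norm_mul, norm_pow, Real.norm_of_nonneg (by positivity : 0 ≤ 1 + ‖x‖), pow_add,
    mul_left_comm]
  exact mul_le_mul_of_nonneg_left (hfC x) (by positivity)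

end Assumptions

theorem theorem3p4_general {d : ℕ} {f : Inp d → ℝ} (hfm : Measurable f)
    (hf : Integrable (fun x => (1 + ‖x‖) ^ 2 * f x) (stdGaussian (Inp d)))
    {σ ξa ξw : ℝ → ℝ} {Kσ Kξ Kρ : ℝ} (hσ : IsBoundedC11 σ Kσ)
    (hξa : Measurable ((Ici 0).domRestrict ξa)) (hξw : Measurable ((Ici 0).domRestrict ξw))
    (hξa_le : ∀ t, 0 ≤ t → |ξa t| ≤ Kξ) (hξw_le : ∀ t, 0 ≤ t → |ξw t| ≤ Kξ)
    {ρ₀ : Measure (Param d)} (ha : ∀ᵐ θ ∂ρ₀, |θ.1| ≤ Kρ)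
    {ρ : ℝ → ProbabilityMeasure (Param d)} (hρ : IsMeanFieldSolution σ f ξa ξw ρ₀ ρ)
    {S : Submodule ℝ (Inp d)} (hS : ρ₀.map (projS S) = Measure.dirac 0)
    (hcond : ∀ w, ∫ x, (f x * deriv σ (inner ℝ w (x - S.starProjection x))) •
      S.starProjection x ∂stdGaussian (Inp d) = 0) {t : ℝ} (ht : 0 ≤ t) :
    (ρ t : Measure (Param d)).map (projS S) = Measure.dirac 0 := by
  have hmax : Measurable fun t : ℝ => (⟨max t 0, le_max_right t 0⟩ : Ici (0 : ℝ)) := by fun_prop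
  have hw : ∀ᵐ θ ∂ρ₀, S.starProjection θ.2 = 0 := by
    rw [← hρ.initial] at hS ⊢
    exact (map_projS_eq_dirac_iff S _).1 hS
  have key := hρ.comp_max.ae_starProjection_snd_eq_zero_of_continuous hρ.continuous_comp_max hσ
    hfm hf (hξa.comp hmax) (hξw.comp hmax) (fun t => hξa_le _ (le_max_right t 0))
    (fun t => hξw_le _ (le_max_right t 0)) ha hw hcond ht
  rw [max_eq_left ht] at key
  exact (map_projS_eq_dirac_iff S _).2 key

end

theorem theorem3p4 (d : ℕ)
    (V : Submodule ℝ (Inp d)) (f : Inp d → ℝ) (hf : IsSubspaceSparsePolynomial V f)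
    (σ ξa ξw : ℝ → ℝ) (Kσ Kξ Kρ : ℝ) (hKσ : 0 < Kσ) (hKξ : 0 < Kξ) (hKρ : 0 < Kρ)
    (hσ : ActivationAssumption σ Kσ)
    (hξa : LearningRateAssumption ξa Kξ) (hξw : LearningRateAssumption ξw Kξ)
    (ρ₀ : MeasureTheory.Measure (Param d)) (hρ₀ : InitialAssumption ρ₀ Kρ)
    (ρ : ℝ → MeasureTheory.ProbabilityMeasure (Param d))
    (hρ : IsMeanFieldSolution σ f ξa ξw ρ₀ ρ)
    (S : Submodule ℝ (Inp d))
    (hS : ρ₀.map (projS S) = MeasureTheory.Measure.dirac (0 : S))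
    (hcond : ∀ w : Inp d,
      ∫ x, (f x * deriv σ (inner ℝ w (x - (S.orthogonalProjectionOnto x : Inp d)))) •
        (S.orthogonalProjectionOnto x : Inp d) ∂(ProbabilityTheory.stdGaussian (Inp d)) = 0) :
    ∀ t : ℝ, 0 ≤ t →
      (ρ t : MeasureTheory.Measure (Param d)).map (projS S) =
        MeasureTheory.Measure.dirac (0 : S) := by
  intro t ht
  exact theorem3p4_general hf.continuous.measurable hf.integrable_sq_mul
    hσ.isBoundedC11 hξa.measurable_domRestrict hξw.measurable_domRestrict hξa.abs_le hξw.abs_le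
    hρ₀.ae_abs_fst_le hρ hS hcond ht
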